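/- Let $E$ be a finite set. An oriented matroid $\mathcal M$ on $E$ is given by its set of covectors $\mathcal C\subseteq\{0,+1,-1\}^E$, satisfying: $0\in\mathcal C$; $-X\in\mathcal C$ for $X\in\mathcal C$; $X\circ Y\in\mathcal C$ for $X,Y\in\mathcal C$, where $(X\circ Y)_i=X_i$ if $X_i\neq0$ and $(X\circ Y)_i=Y_i$ otherwise; and for $X,Y\in\mathcal C$ and $i\in S(X,Y)=\{j: X_j=-Y_j\ne0\}$ there is $Z\in\mathcal C$ with $Z_i=0$ and $Z_j=(X\circ Y)_j$ for all $j\notin S(X,Y)$. Its underlying matroid $M$ is the matroid on $E$ whose flats are the sets $\{i : X_i=0\}$, $X\in\mathcal C$; $\mathcal M$ is loopfree if $M$ has no loops. Its topes are the covectors that are maximal for the coordinatewise order given by $0<+1$ and $0<-1$. For a set $\mathcal F$ of flats, $\mathcal T(\mathcal F)$ is the set of topes $T$ such that for every $F\in\mathcal F$ the vector $T\setminus F$, obtained from $T$ by setting the coordinates in $F$ to $0$, is a covector. A rational polyhedral fan $\Sigma$ in $\mathbb R^E$ is a finite collection of convex cones, each generated by finitely many integer vectors, such that every face of a cone of $\Sigma$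 is in $\Sigma$ and the intersection of two cones of $\Sigma$ is a face of both. Its facets are its inclusion-maximal cones; it is pure of dimension $d$ if all facets have dimension $d$. A real phase structure on such a $\Sigma$, pure of dimension $d$, is a map $\mathcal E$ assigning to each facet $\sigma$ a $d$-dimensional affine subspace $\mathcal E(\sigma)\subseteq\mathbb Z_2^E$ whose direction space is $T_{\mathbb Z_2}(\sigma)$, the reduction mod $2$ of the integer points of the linear span of $\sigma$, such that for every cone $\tau\in\Sigma$ of dimension $d-1$ and every $\varepsilon\in\mathbb Z_2^E$ the number of facets $\sigma\supseteq\tau$ with $\varepsilon\in\mathcal E(\sigma)$ is even. For an arbitrary $\tau\in\Sigma$ put $\mathcal E(\tau)=\bigcup_{\sigma\supseteq\tau}\mathcal E(\sigma)$, the union over the facets $\sigma$ containing $\tau$. For fans $\Sigma',\Sigma$ with real phase structures $\mathcal E',\mathcal E$, the pair $(\Sigma',\mathcal E')$ is a real subfan of $(\Sigma,\mathcal E)$ if every cone of $\Sigma'$ is a cone of $\Sigma$ and $\mathcal E'(\tau)\subseteq\mathcal E(\tau)$ for all $\tau\in\Sigma'$. For a loopfree matroid $M$ on $E$ put $v_F=-\sum_{i\in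 F}e_i\in\mathbb R^E$ for $F\subseteq E$. The affine matroid fan $\Sigma_M$ consists of the cones $\sigma_{\mathcal F}=\langle v_{F_1},\dots,v_{F_k},v_E,-v_E\rangle_{\ge0}$ over all flags $\mathcal F=\{F_1\subsetneq\dots\subsetneq F_k\}$, $k\ge0$, of flats of $M$ other than $\emptyset$ and $E$. Its facets are the cones of the maximal flags. For a loopfree oriented matroid $\mathcal M$ with underlying matroid $M$, the real phase structure $\mathcal E_{\mathcal M}$ on $\Sigma_M$ is given by $\mathcal E_{\mathcal M}(\sigma_{\mathcal F})=\{\varepsilon\in\mathbb Z_2^E:(-1)^{\varepsilon}\in\mathcal T(\mathcal F)\}$ for each maximal flag $\mathcal F$. **Proposition.** Let $\mathcal M_1,\mathcal M_2$ be loopfree oriented matroids on $E$, with underlying matroids $M_1,M_2$, and write $\Sigma_i=\Sigma_{M_i}$ and $\mathcal E_i=\mathcal E_{\mathcal M_i}$. Then $\mathcal M_1$ is a quotient of $\mathcal M_2$, that is, every covector of $\mathcal M_1$ is a covector of $\mathcal M_2$, if and only if $(\Sigma_1,\mathcal E_1)$ is a real subfan of $(\Sigma_2,\mathcal E_2)$.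 -/

import Mathlib

noncomputable section

open Set

/-! ### Sign vectors -/

namespace SignVec

variable {E : Type*}

/-- The composition `X ∘ Y`: it agrees with `X` where `X` is nonzero and with `Y` elsewhere. -/
def comp (X Y : E → SignType) : E → SignType := fun i => if X i = 0 then Y i else X i

/-- The separation set `S(X, Y)`. -/
def sep (X Y : E → SignType) : Set E := {i | X i = -Y i ∧ X i ≠ 0}

/-- The coordinatewise partial order induced by `0 < +1` and `0 < -1`
(this is not the order of `SignType`, in which `-1 < 0 < 1`). -/
def Le (X Y : E → SignType) : Prop := ∀ i, X i = 0 ∨ X i = Y i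

open Classical in
/-- The sign vector `T \ F`: all coordinates in `F` are set to `0`. -/
def erase (T : E → SignType) (F : Set E) : E → SignType := fun i => if i ∈ F then 0 else T i

/-- The vector `(-1)^ε`. -/
def ofZMod (ε : E → ZMod 2) : E → SignType := fun i => if ε i = 0 then 1 else -1

end SignVec

/-! ### Oriented matroids -/

/-- An oriented matroid on the ground set `E`, given by its covectors. -/
structure OrientedMatroid (E : Type*) where
  covectors : Set (E → SignType)
  zero_mem : (0 : E → SignType) ∈ covectors
  neg_mem : ∀ X ∈ covectors, -X ∈ covectors
  comp_mem : ∀ X ∈ covectors, ∀ Y ∈ covectors, SignVec.comp X Y ∈ covectors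
  elim : ∀ X ∈ covectors, ∀ Y ∈ covectors, ∀ i ∈ SignVec.sep X Y,
    ∃ Z ∈ covectors, Z i = 0 ∧ ∀ j, j ∉ SignVec.sep X Y → Z j = SignVec.comp X Y j

namespace OrientedMatroid

variable {E : Type*} (O : OrientedMatroid E)

/-- `O₁` is a quotient of `O₂` if all covectors of `O₁` are covectors of `O₂`. -/
def IsQuotient (O₁ O₂ : OrientedMatroid E) : Prop := O₁.covectors ⊆ O₂.covectors

/-- The topes: the maximal covectors. -/
def IsTope (T : E → SignType) : Prop :=
  T ∈ O.covectors ∧ ∀ Y ∈ O.covectors, SignVec.Le T Y → Y = T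

/-- The set `𝒯(𝓕)` of topes adjacent to every member of `𝓕`. -/
def adjacentTopes (𝓕 : Set (Set E)) : Set (E → SignType) :=
  {T | O.IsTope T ∧ ∀ F ∈ 𝓕, SignVec.erase T F ∈ O.covectors}

/-- The closure of `A`: the elements at which every covector that vanishes on `A` vanishes. -/
def cl (A : Set E) : Set E :=
  {e | ∀ X ∈ O.covectors, (∀ a ∈ A, X a = 0) → X e = 0}

/-- `I` is independent in the underlying matroid if no element of `I` is in the closure of the
others. -/
def Indep (I : Set E) : Prop := ∀ e ∈ I, e ∉ O.cl (I \ {e})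

variable {O}

lemma subset_cl (A : Set E) : A ⊆ O.cl A := fun _ ha _ _ h => h _ ha

lemma cl_mono {A B : Set E} (h : A ⊆ B) : O.cl A ⊆ O.cl B :=
  fun _ he X hX hB => he X hX fun a ha => hB a (h ha)

lemma cl_subset_cl {A B : Set E} (h : A ⊆ O.cl B) : O.cl A ⊆ O.cl B :=
  fun _ he X hX hB => he X hX fun _ ha => h ha X hX hB

lemma cl_exchange {A : Set E} {e f : E} (h : f ∈ O.cl (insert e A)) (hf : f ∉ O.cl A) :
    e ∈ O.cl (insert f A) := by
  intro X hX hXA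
  by_contra hXe
  simp only [cl, mem_ofPred_eq, not_forall] at hf
  obtain ⟨Y, hY, hYA, hYf⟩ := hf
  have hXf : X f = 0 := hXA f (mem_insert _ _)
  have hYe : Y e ≠ 0 := by
    intro h0
    refine hYf (h Y hY ?_)
    rintro a (rfl | ha)
    exacts [h0, hYA a ha]
  -- choose a sign of `Y` so that `e` separates
  obtain ⟨W, hW, hWA, hWf, hWe⟩ : ∃ W ∈ O.covectors, (∀ a ∈ A, W a = 0) ∧ W f ≠ 0 ∧
      X e = -W e := by
    by_cases hs : X e = -Y e
    · exact ⟨Y, hY, hYA, hYf, hs⟩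
    · refine ⟨-Y, O.neg_mem Y hY, fun a ha => by simp [hYA a ha], by simpa using hYf, ?_⟩
      revert hXe hYe hs
      simp only [Pi.neg_apply]
      generalize X e = x
      generalize Y e = y
      revert x y
      decide
  obtain ⟨Z, hZ, hZe, hZj⟩ := O.elim X hX W hW e ⟨hWe, hXe⟩
  have hZf : Z f = W f := by
    rw [hZj f (fun hs => hs.2 hXf)]
    simp [SignVec.comp, hXf]
  refine hWf (hZf ▸ h Z hZ ?_)
  rintro a (rfl | ha)
  · exact hZe
  · have hXa : X a = 0 := hXA a (mem_insert_of_mem _ ha)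
    rw [hZj a (fun hs => hs.2 hXa)]
    simp [SignVec.comp, hXa, hWA a ha]

lemma Indep.subset {I J : Set E} (hJ : O.Indep J) (h : I ⊆ J) : O.Indep I :=
  fun e he hcl => hJ e (h he) (cl_mono (sdiff_subset_sdiff_left h) hcl)

lemma Indep.insert_of_notMem {I : Set E} {e : E} (hI : O.Indep I) (he : e ∉ O.cl I) :
    O.Indep (insert e I) := by
  have heI : e ∉ I := fun h => he (subset_cl I h)
  rintro x (rfl | hx) hcl
  · rw [insert_sdiff_of_mem _ (mem_singleton _), sdiff_singleton_eq_self heI] at hcl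
    exact he hcl
  · have hne : e ≠ x := fun h => heI (h ▸ hx)
    rw [insert_sdiff_of_notMem _ (by simpa using hne)] at hcl
    have := cl_exchange hcl (hI x hx)
    rw [insert_sdiff_singleton, insert_eq_of_mem hx] at this
    exact he this

lemma Indep.ncard_le [Finite E] {I : Set E} : ∀ (n : ℕ) (J : Set E), (J \ I).ncard = n →
    O.Indep J → J ⊆ O.cl I → J.ncard ≤ I.ncard := by
  intro n
  induction n with
  | zero =>
    intro J hn _ _
    rw [ncard_eq_zero (toFinite _), sdiff_eq_empty] at hn
    exact ncard_le_ncard hn (toFinite _)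
  | succ n ih =>
    intro J hn hJ hJI
    obtain ⟨e, heJ, heI⟩ : (J \ I).Nonempty := by
      rw [← ncard_pos (toFinite _)]; omega
    obtain ⟨f, hfI, hf⟩ : ∃ f ∈ I, f ∉ O.cl (J \ {e}) := by
      by_contra hcon
      push Not at hcon
      exact hJ e heJ (cl_subset_cl hcon (hJI heJ))
    have hfJ : f ∉ J \ {e} := fun h => hf (subset_cl _ h)
    have hcard : (insert f (J \ {e})).ncard = J.ncard := by
      rw [ncard_insert_of_notMem hfJ (toFinite _), ncard_sdiff_singleton_add_one heJ (toFinite _)]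
    rw [← hcard]
    refine ih _ ?_ ((hJ.subset sdiff_subset).insert_of_notMem hf) ?_
    · have : insert f (J \ {e}) \ I = (J \ I) \ {e} := by
        rw [insert_sdiff_of_mem _ hfI, sdiff_sdiff_comm]
      rw [this]
      have := ncard_sdiff_singleton_add_one (s := J \ I) ⟨heJ, heI⟩ (toFinite _)
      omega
    · exact insert_subset (subset_cl _ hfI) (sdiff_subset.trans hJI)

variable (O)

/-- The underlying matroid. -/
def toMatroid [Finite E] : Matroid E :=
  (IndepMatroid.ofFinite (E := univ) finite_univ O.Indep (fun e he => he.elim)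
    (fun _ _ hJ h => hJ.subset h)
    (by
      intro I J hI hJ hlt
      by_contra hcon
      push Not at hcon
      refine absurd (Indep.ncard_le _ J rfl hJ fun e he => ?_) (not_le.mpr hlt)
      by_cases heI : e ∈ I
      · exact subset_cl _ heI
      · by_contra hecl
        exact hcon e he heI (hI.insert_of_notMem hecl))
    (fun _ _ => subset_univ _)).matroid

lemma toMatroid_closure [Finite E] (A : Set E) : O.toMatroid.closure A = O.cl A := by
  obtain ⟨I, hI⟩ := O.toMatroid.exists_isBasis A (subset_univ _)
  have hI' : O.Indep I := hI.indep
  have hAI : A ⊆ O.cl I := by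
    intro a ha
    by_contra h
    exact h (subset_cl _ (hI.mem_of_insert_indep ha (hI'.insert_of_notMem h)))
  rw [← hI.closure_eq_closure]
  ext e
  rw [hI.indep.mem_closure_iff']
  constructor
  · rintro ⟨-, h⟩
    refine cl_mono hI.subset ?_
    by_contra hecl
    exact hecl (subset_cl _ (h (hI'.insert_of_notMem hecl)))
  · intro he
    refine ⟨mem_univ e, fun h => ?_⟩
    by_contra heI
    have h' : O.Indep (insert e I) := h
    refine h' e (mem_insert _ _) ?_
    rw [insert_sdiff_of_mem _ (mem_singleton _), sdiff_singleton_eq_self heI]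
    exact cl_subset_cl hAI he

/-- The flats of the underlying matroid are exactly the complements of supports of covectors. -/
lemma isFlat_iff [Finite E] (F : Set E) :
    O.toMatroid.IsFlat F ↔ ∃ X ∈ O.covectors, {e | X e = 0} = F := by
  rw [Matroid.isFlat_iff_closure_eq, toMatroid_closure]
  constructor
  · intro hF
    have key : ∀ S : Set E, S.Finite → S ⊆ Fᶜ →
        ∃ X ∈ O.covectors, (∀ a ∈ F, X a = 0) ∧ ∀ a ∈ S, X a ≠ 0 := by
      intro S hS
      induction S, hS using Set.Finite.induction_on with
      | empty => exact fun _ => ⟨0, O.zero_mem, by simp, by simp⟩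
      | @insert b S hb _ ih =>
        intro hsub
        obtain ⟨X, hX, hXF, hXS⟩ := ih ((subset_insert _ _).trans hsub)
        have hbF : b ∉ O.cl F := hF.symm ▸ hsub (mem_insert _ _)
        simp only [cl, mem_ofPred_eq, not_forall] at hbF
        obtain ⟨Y, hY, hYF, hYb⟩ := hbF
        refine ⟨_, O.comp_mem X hX Y hY, fun a ha => by simp [SignVec.comp, hXF a ha, hYF a ha], ?_⟩
        rintro a (rfl | ha)
        · simp only [SignVec.comp]; split_ifs with h <;> assumption
        · simp [SignVec.comp, hXS a ha]
    obtain ⟨X, hX, hXF, hXS⟩ := key Fᶜ (toFinite _) subset_rfl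
    exact ⟨X, hX, Subset.antisymm (fun a ha => by by_contra h; exact hXS a h ha) hXF⟩
  · rintro ⟨X, hX, rfl⟩
    exact Subset.antisymm (fun e he => he X hX fun a ha => ha) (subset_cl _)

/-- A loopfree oriented matroid: the underlying matroid has no loops. -/
def Loopfree [Finite E] : Prop := O.toMatroid.Loopless

end OrientedMatroid

/-! ### Rational fans and real phase structures -/

section Fans

variable {E : Type*}

/-- The dimension of a cone in `ℝ^E`: the dimension of its real linear span. -/
def coneDim (σ : PointedCone ℝ (E → ℝ)) : ℕ :=
  Module.finrank ℝ (Submodule.span ℝ (σ : Set (E → ℝ)))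

/-- The space `T_{ℤ₂}(σ)`: the reductions mod 2 of the integer points of the linear span
of `σ`. -/
def tangentZMod2 (σ : PointedCone ℝ (E → ℝ)) : Set (E → ZMod 2) :=
  (fun (z : E → ℤ) (i : E) => (z i : ZMod 2)) ''
    {z | (fun i => (z i : ℝ)) ∈ Submodule.span ℝ (σ : Set (E → ℝ))}

/-- A (finite) rational polyhedral fan in `ℝ^E`. -/
structure IsRationalFan (Φ : Set (PointedCone ℝ (E → ℝ))) : Prop where
  finite : Φ.Finite
  rational : ∀ σ ∈ Φ, ∃ S : Finset (E → ℤ),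
    σ = PointedCone.hull ℝ ((fun (z : E → ℤ) (i : E) => (z i : ℝ)) '' (S : Set (E → ℤ)))
  face_mem : ∀ σ ∈ Φ, ∀ τ : PointedCone ℝ (E → ℝ), τ.IsFaceOf σ → τ ∈ Φ
  inter : ∀ σ ∈ Φ, ∀ τ ∈ Φ, (σ ⊓ τ).IsFaceOf σ ∧ (σ ⊓ τ).IsFaceOf τ

/-- The facets of a fan: the cones that are maximal with respect to inclusion. -/
def facets (Φ : Set (PointedCone ℝ (E → ℝ))) : Set (PointedCone ℝ (E → ℝ)) :=
  {σ | Maximal (· ∈ Φ) σ}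

/-- `ℰ` is a real phase structure on the rational polyhedral fan `Φ` of pure dimension `d`. -/
structure IsRealPhaseStructure (Φ : Set (PointedCone ℝ (E → ℝ))) (d : ℕ)
    (ℰ : facets Φ → Set (E → ZMod 2)) : Prop where
  fan : IsRationalFan Φ
  pure : ∀ σ ∈ facets Φ, coneDim σ = d
  /-- `ℰ σ` is a `d`-dimensional affine subspace of `ℤ₂^E` parallel to `σ`. -/
  parallel : ∀ σ : facets Φ, ∃ A : AffineSubspace (ZMod 2) (E → ZMod 2),
    (A : Set (E → ZMod 2)).Nonempty ∧ (A : Set (E → ZMod 2)) = ℰ σ ∧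
    Module.finrank (ZMod 2) A.direction = d ∧
    (A.direction : Set (E → ZMod 2)) = tangentZMod2 (σ : PointedCone ℝ (E → ℝ))
  /-- For every cone `τ` of codimension one, every `ε` lies in `ℰ σ` for an even number of the
  facets `σ` adjacent to `τ`. The facets are counted, not the sets `ℰ σ`, which may coincide. -/
  even_covering : ∀ τ ∈ Φ, coneDim τ + 1 = d → ∀ ε : E → ZMod 2,
    Even {σ : facets Φ | τ ≤ (σ : PointedCone ℝ (E → ℝ)) ∧ ε ∈ ℰ σ}.ncard

/-- The extension of `ℰ` to all cones: `ℰ τ` is the union of the `ℰ σ` over the facets `σ`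
that contain `τ`. -/
def phaseAt {Φ : Set (PointedCone ℝ (E → ℝ))} (ℰ : facets Φ → Set (E → ZMod 2))
    (τ : PointedCone ℝ (E → ℝ)) : Set (E → ZMod 2) :=
  ⋃ (σ : facets Φ) (_ : τ ≤ (σ : PointedCone ℝ (E → ℝ))), ℰ σ

/-- `(Φ', ℰ')` is a real subfan of `(Φ, ℰ)`, where `ℰ'` and `ℰ` are real phase structures on the
fans `Φ'` and `Φ`, and the inclusion `Φ' ⊆ Φ` is an inclusion of collections of cones. -/
structure IsRealSubfan (Φ' : Set (PointedCone ℝ (E → ℝ))) (ℰ' : facets Φ' → Set (E → ZMod 2))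
    (Φ : Set (PointedCone ℝ (E → ℝ))) (ℰ : facets Φ → Set (E → ZMod 2)) : Prop where
  phase_sub : ∃ d, IsRealPhaseStructure Φ' d ℰ'
  phase : ∃ d, IsRealPhaseStructure Φ d ℰ
  subset : Φ' ⊆ Φ
  phase_subset : ∀ τ ∈ Φ', phaseAt ℰ' τ ⊆ phaseAt ℰ τ

/-! ### Matroid fans -/

/-- A flag of flats `∅ ⊊ F₁ ⊊ ⋯ ⊊ F_k ⊊ E` in a loopfree matroid with ground set `E`, recorded
as the set `{F₁, …, F_k}`. -/
def IsFlag (M : Matroid E) (𝓕 : Set (Set E)) : Prop :=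
  (∀ F ∈ 𝓕, M.IsFlat F ∧ F ≠ ∅ ∧ F ≠ univ) ∧ IsChain (· ⊆ ·) 𝓕

/-- The vector `v_F = -∑_{i ∈ F} e_i`. -/
def flatVec (F : Set E) : E → ℝ := F.indicator fun _ => -1

/-- The cone `σ_𝓕 = ⟨v_{F₁}, …, v_{F_k}, v_E, -v_E⟩_{≥ 0}`. -/
def flagCone (𝓕 : Set (Set E)) : PointedCone ℝ (E → ℝ) :=
  PointedCone.hull ℝ (flatVec '' 𝓕 ∪ {flatVec univ, -flatVec univ})

/-- The affine matroid fan of a loopfree matroid with ground set `E`. -/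
def matroidFan (M : Matroid E) : Set (PointedCone ℝ (E → ℝ)) :=
  {σ | ∃ 𝓕, IsFlag M 𝓕 ∧ flagCone 𝓕 = σ}

/-- The fan of the underlying matroid of a loopfree oriented matroid. -/
def OrientedMatroid.fan [Finite E] (O : OrientedMatroid E) : Set (PointedCone ℝ (E → ℝ)) :=
  matroidFan O.toMatroid

/-- The real phase structure of a loopfree oriented matroid: the facet `σ_𝓕` of the maximal
flag `𝓕` (which is determined by the facet) is sent to `{ε | (-1)^ε ∈ 𝒯(𝓕)}`. -/
def OrientedMatroid.phase [Finite E] (O : OrientedMatroid E) :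
    facets O.fan → Set (E → ZMod 2) :=
  fun σ => {ε | ∃ 𝓕, Maximal (IsFlag O.toMatroid) 𝓕 ∧
    flagCone 𝓕 = (σ : PointedCone ℝ (E → ℝ)) ∧ SignVec.ofZMod ε ∈ O.adjacentTopes 𝓕}

end Fans

end

/-! A vector lies in the cone of a flag exactly when all its sublevel sets are members of the flag,
empty or the whole ground set (`mem_flagCone_iff`). Hence cones and flags determine each other,
faces correspond to subflags, and the span of a cone consists of the functions constant on the
atoms, the differences of consecutive flats.

The phases are controlled by `mem_phaseAt`: for every flag `𝓖`, maximal or not, `ε ∈ ℰ(σ_𝓖)` if and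
only if the tope `(-1)^ε` is adjacent to all flats of `𝓖`. The substance is that a flag adjacent to
a tope refines to a maximal flag adjacent to it (`exists_maximal_adjacent`), which rests on an
elimination argument producing walls (`exists_wall`).

If covectors of `O₁` are covectors of `O₂`, then flats, flags, nowhere zero covectors and adjacency
all pass from `O₁` to `O₂`, and `mem_phaseAt` gives the subfan. Conversely, let `X` be a covector of
`O₁` with zero set `F`, and let `T = X ∘ T₀` with `T₀` a tope. Then `T \ F = X`, so `T` is adjacent
to the flag `{F}` in `O₁`, hence in `O₂`, and so `X = T \ F` is a covector of `O₂`.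

A real subfan also requires `ℰ` to be a real phase structure. Purity holds because representatives
of the atoms of a maximal flag form a basis. The phase of a facet is affine because the topes
adjacent to a maximal flag arise from one of them by independent sign changes on the atoms. The even
covering holds because a tope adjacent to a flag of corank one has either no wall or exactly two in
its gap: a first wall forces a second (`exists_wall`), and a third is impossible in rank two
(`not_three_walls`). -/

noncomputable section

open Set

/-! ### Chains of subsets -/

section Chains

variable {E : Type*}

/-- The members of `𝓕` together with the empty set and the whole ground set. -/
def levels (𝓕 : Set (Set E)) : Set (Set E) := insert ∅ (insert univ 𝓕)

lemma empty_mem_levels (𝓕 : Set (Set E)) : ∅ ∈ levels 𝓕 := mem_insert _ _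

lemma univ_mem_levels (𝓕 : Set (Set E)) : univ ∈ levels 𝓕 :=
  mem_insert_of_mem _ (mem_insert _ _)

lemma subset_levels (𝓕 : Set (Set E)) : 𝓕 ⊆ levels 𝓕 :=
  (subset_insert _ _).trans (subset_insert _ _)

lemma mem_of_mem_levels {𝓕 : Set (Set E)} {F : Set E} (h : F ∈ levels 𝓕) (h0 : F ≠ ∅)
    (h1 : F ≠ univ) : F ∈ 𝓕 := by
  rcases h with h | h | h
  exacts [absurd h h0, absurd h h1, h]

lemma IsChain.levels {𝓕 : Set (Set E)} (h : IsChain (· ⊆ ·) 𝓕) :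
    IsChain (· ⊆ ·) (levels 𝓕) :=
  (h.insert fun _ _ _ => Or.inr (subset_univ _)).insert fun _ _ _ => Or.inl (empty_subset _)

lemma IsChain.subset_or_subset {𝓕 : Set (Set E)} (h : IsChain (· ⊆ ·) 𝓕) {A B : Set E}
    (hA : A ∈ 𝓕) (hB : B ∈ 𝓕) : A ⊆ B ∨ B ⊆ A := h.total hA hB

lemma IsChain.sUnion_mem [Finite E] {𝓕 : Set (Set E)} (h : IsChain (· ⊆ ·) 𝓕)
    (hne : 𝓕.Nonempty) : ⋃₀ 𝓕 ∈ 𝓕 := by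
  obtain ⟨m, hm⟩ := (toFinite 𝓕).exists_maximal hne
  have : ⋃₀ 𝓕 = m := by
    refine Subset.antisymm (sUnion_subset fun A hA => ?_) (subset_sUnion_of_mem hm.1)
    rcases h.subset_or_subset hA hm.1 with h | h
    exacts [h, hm.2 hA h]
  rw [this]
  exact hm.1

lemma IsChain.sInter_mem [Finite E] {𝓕 : Set (Set E)} (h : IsChain (· ⊆ ·) 𝓕)
    (hne : 𝓕.Nonempty) : ⋂₀ 𝓕 ∈ 𝓕 := by
  obtain ⟨m, hm⟩ := (toFinite 𝓕).exists_minimal hne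
  have : ⋂₀ 𝓕 = m := by
    refine Subset.antisymm (sInter_subset_of_mem hm.1) (subset_sInter fun A hA => ?_)
    rcases h.subset_or_subset hA hm.1 with h | h
    exacts [hm.2 hA h, h]
  rw [this]
  exact hm.1

/-- The largest member of the chain `𝓕` that does not contain `i` (`∅` if there is none). -/
def lower (𝓕 : Set (Set E)) (i : E) : Set E := ⋃₀ {F ∈ 𝓕 | i ∉ F}

/-- The smallest member of the chain `𝓕` that contains `i` (`univ` if there is none). -/
def upper (𝓕 : Set (Set E)) (i : E) : Set E := ⋂₀ {F ∈ 𝓕 | i ∈ F}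

/-- Two elements are in the same atom if they belong to the same members of `𝓕`. -/
def atomSetoid (𝓕 : Set (Set E)) : Setoid E where
  r i j := ∀ F ∈ 𝓕, i ∈ F ↔ j ∈ F
  iseqv := ⟨fun _ _ _ => Iff.rfl, fun h F hF => (h F hF).symm,
    fun h h' F hF => (h F hF).trans (h' F hF)⟩

variable {𝓕 : Set (Set E)} {i j : E} {F : Set E}

lemma notMem_lower (𝓕 : Set (Set E)) (i : E) : i ∉ lower 𝓕 i := by
  rintro ⟨F, ⟨-, hF⟩, hi⟩
  exact hF hi

lemma mem_upper (𝓕 : Set (Set E)) (i : E) : i ∈ upper 𝓕 i := fun _ hF => hF.2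

lemma subset_lower (hF : F ∈ 𝓕) (hi : i ∉ F) : F ⊆ lower 𝓕 i := subset_sUnion_of_mem ⟨hF, hi⟩

lemma upper_subset (hF : F ∈ 𝓕) (hi : i ∈ F) : upper 𝓕 i ⊆ F := sInter_subset_of_mem ⟨hF, hi⟩

lemma lower_subset_upper (h : IsChain (· ⊆ ·) 𝓕) (i : E) : lower 𝓕 i ⊆ upper 𝓕 i := by
  rintro x ⟨F, ⟨hF, hiF⟩, hx⟩ G ⟨hG, hiG⟩
  rcases h.subset_or_subset hF hG with h | h
  exacts [h hx, absurd (h hiG) hiF]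

lemma lower_mem_or [Finite E] (h : IsChain (· ⊆ ·) 𝓕) (i : E) :
    lower 𝓕 i ∈ 𝓕 ∨ lower 𝓕 i = ∅ := by
  rcases {F ∈ 𝓕 | i ∉ F}.eq_empty_or_nonempty with he | he
  · right
    rw [lower, he, sUnion_empty]
  · exact Or.inl ((h.mono (sep_subset _ _)).sUnion_mem he).1

lemma upper_mem_or [Finite E] (h : IsChain (· ⊆ ·) 𝓕) (i : E) :
    upper 𝓕 i ∈ 𝓕 ∨ upper 𝓕 i = univ := by
  rcases {F ∈ 𝓕 | i ∈ F}.eq_empty_or_nonempty with he | he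
  · right
    rw [upper, he, sInter_empty]
  · exact Or.inl ((h.mono (sep_subset _ _)).sInter_mem he).1

lemma atomSetoid_iff_mem :
    atomSetoid 𝓕 i j ↔ j ∈ upper 𝓕 i ∧ j ∉ lower 𝓕 i := by
  refine ⟨fun hij => ⟨fun F hF => (hij F hF.1).1 hF.2, ?_⟩, fun ⟨h1, h2⟩ F hF => ⟨fun hi => ?_,
    fun hj => ?_⟩⟩
  · rintro ⟨F, ⟨hF, hi⟩, hj⟩
    exact hi ((hij F hF).2 hj)
  · exact h1 F ⟨hF, hi⟩
  · by_contra hi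
    exact h2 ⟨F, ⟨hF, hi⟩, hj⟩

lemma lower_eq_of_atom (h : atomSetoid 𝓕 i j) : lower 𝓕 i = lower 𝓕 j := by
  unfold lower
  congr 1
  ext F
  exact and_congr_right fun hF => not_congr (h F hF)

lemma upper_eq_of_atom (h : atomSetoid 𝓕 i j) : upper 𝓕 i = upper 𝓕 j := by
  unfold upper
  congr 1
  ext F
  exact and_congr_right fun hF => h F hF

lemma atom_of_upper_eq (h : upper 𝓕 i = upper 𝓕 j) : atomSetoid 𝓕 i j :=
  fun _ hF => ⟨fun hi => upper_subset hF hi (h ▸ mem_upper 𝓕 j),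
    fun hj => upper_subset hF hj (h ▸ mem_upper 𝓕 i)⟩

/-- Any element of `F` outside the next smaller member of the chain will do. -/
lemma exists_upper_eq [Finite E] (h : IsChain (· ⊆ ·) 𝓕) (hF : F ∈ 𝓕 ∨ F = univ)
    (hne : F.Nonempty) : ∃ i ∈ F, upper 𝓕 i = F := by
  obtain ⟨i, hiF, hi⟩ : ∃ i ∈ F, ∀ G ∈ 𝓕, G ⊂ F → i ∉ G := by
    rcases {G ∈ 𝓕 | G ⊂ F}.eq_empty_or_nonempty with he | he
    · obtain ⟨i, hi⟩ := hne
      exact ⟨i, hi, fun G hG hGF => absurd (show G ∈ {G ∈ 𝓕 | G ⊂ F} from ⟨hG, hGF⟩) (by simp [he])⟩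
    · obtain ⟨i, hi, hi'⟩ := exists_of_ssubset ((h.mono (sep_subset _ _)).sUnion_mem he).2
      exact ⟨i, hi, fun G hG hGF hiG => hi' ⟨G, ⟨hG, hGF⟩, hiG⟩⟩
  refine ⟨i, hiF, Subset.antisymm ?_ fun x hx G hG => ?_⟩
  · rcases hF with hF | rfl
    exacts [upper_subset hF hiF, subset_univ _]
  · by_contra hxG
    refine hi G hG.1 ?_ hG.2
    rcases hF with hF | rfl
    · rcases h.subset_or_subset hF hG.1 with h | h
      exacts [absurd (h hx) hxG, ⟨h, fun h' => hxG (h' hx)⟩]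
    · exact ⟨subset_univ _, fun h' => hxG (h' hx)⟩

/-- An atom is determined by the smallest member containing it. The extra one counts the top atom,
whose `upper` is `univ`. -/
lemma card_atoms [Finite E] [Nonempty E] (h : IsChain (· ⊆ ·) 𝓕)
    (h' : ∀ F ∈ 𝓕, F ≠ ∅ ∧ F ≠ univ) : Nat.card (Quotient (atomSetoid 𝓕)) = 𝓕.ncard + 1 := by
  rw [← ncard_insert_of_notMem (a := univ) (fun hu => (h' _ hu).2 rfl) (toFinite _)]
  refine Nat.card_eq_of_bijective
    (Quotient.lift (fun i => (⟨upper 𝓕 i, (upper_mem_or h i).symm⟩ : (insert univ 𝓕 : Set (Set E))))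
      fun i j hij => Subtype.ext (upper_eq_of_atom hij)) ⟨?_, ?_⟩
  · rintro ⟨i⟩ ⟨j⟩ hij
    exact Quotient.sound (atom_of_upper_eq (congrArg Subtype.val hij))
  · rintro ⟨F, hF⟩
    have hne : F.Nonempty := by
      rcases hF with rfl | hF
      exacts [univ_nonempty, nonempty_iff_ne_empty.2 (h' F hF).1]
    obtain ⟨i, -, hi⟩ := exists_upper_eq h (Or.symm hF) hne
    exact ⟨Quotient.mk _ i, Subtype.ext hi⟩

/-- A set of representatives of the atoms. -/
def atomReps (𝓕 : Set (Set E)) : Set E :=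
  range (Quotient.out : Quotient (atomSetoid 𝓕) → E)

lemma ncard_atomReps (𝓕 : Set (Set E)) :
    (atomReps 𝓕).ncard = Nat.card (Quotient (atomSetoid 𝓕)) :=
  ncard_range_of_injective Quotient.out_injective

lemma eq_of_mem_atomReps {𝓕 : Set (Set E)} {i j : E} (hi : i ∈ atomReps 𝓕)
    (hj : j ∈ atomReps 𝓕) (hij : atomSetoid 𝓕 i j) : i = j := by
  obtain ⟨p, rfl⟩ := hi
  obtain ⟨q, rfl⟩ := hj
  exact congrArg _ (Quotient.out_equiv_out.1 hij)

lemma exists_mem_atomReps (𝓕 : Set (Set E)) (i : E) : ∃ j ∈ atomReps 𝓕, atomSetoid 𝓕 j i :=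
  ⟨_, mem_range_self (Quotient.mk _ i), Quotient.mk_out i⟩

/-- The functions that are constant on the atoms of `𝓕`. -/
def constOnAtoms (R : Type*) [CommRing R] (𝓕 : Set (Set E)) : Submodule R (E → R) where
  carrier := {x | ∀ i j, atomSetoid 𝓕 i j → x i = x j}
  add_mem' hx hy i j h := by simp [hx i j h, hy i j h]
  zero_mem' _ _ _ := rfl
  smul_mem' c x hx i j h := by simp [hx i j h]

lemma constOnAtoms_eq_range (R : Type*) [CommRing R] (𝓕 : Set (Set E)) :
    constOnAtoms R 𝓕 = LinearMap.range
      (LinearMap.funLeft R R (Quotient.mk (atomSetoid 𝓕))) := by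
  ext x
  constructor
  · intro hx
    exact ⟨fun q => Quotient.lift x hx q, rfl⟩
  · rintro ⟨y, rfl⟩ i j hij
    simp only [LinearMap.funLeft_apply]
    rw [Quotient.sound hij]

lemma finrank_constOnAtoms [Finite E] (R : Type*) [Field R] (𝓕 : Set (Set E)) :
    Module.finrank R (constOnAtoms R 𝓕) = Nat.card (Quotient (atomSetoid 𝓕)) := by
  have := Fintype.ofFinite (Quotient (atomSetoid 𝓕))
  rw [constOnAtoms_eq_range, LinearMap.finrank_range_of_inj
    (LinearMap.funLeft_injective_of_surjective R R _ Quotient.mk_surjective),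
    Module.finrank_fintype_fun_eq_card, Nat.card_eq_fintype_card]

end Chains

/-! ### Cones of flags -/

section Cones

variable {E : Type*} {𝓕 𝓖 : Set (Set E)} {x y : E → ℝ}

/-- If `y j < y i`, then `{x ≤ x i}` contains `i` but not `j`, and `{y ≤ y j}` contains `j` but not
`i`, so the two are incomparable. -/
lemma comonotone_of_sublevel {𝓒 : Set (Set E)} (h𝓒 : IsChain (· ⊆ ·) 𝓒)
    (hx : ∀ t, {i | x i ≤ t} ∈ 𝓒) (hy : ∀ t, {i | y i ≤ t} ∈ 𝓒) {i j : E} (hij : x i < x j) :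
    y i ≤ y j := by
  by_contra! hji
  rcases h𝓒.subset_or_subset (hx (x i)) (hy (y j)) with h | h
  · exact absurd (h (le_refl (x i))) (not_le.2 hji)
  · exact absurd (h (le_refl (y j))) (not_le.2 hij)

lemma exists_max_sublevel [Finite E] (y : E → ℝ) {S : Set E} (hS : S.Nonempty) :
    ∃ i ∈ S, ∀ j ∈ S, y j ≤ y i := S.toFinite.exists_maximalFor y S hS |>.imp
      fun i hi => ⟨hi.1, fun j hj => (le_total (y j) (y i)).elim id fun h => hi.2 hj h⟩

lemma sublevel_add_mem [Finite E] {𝓒 : Set (Set E)} (h𝓒 : IsChain (· ⊆ ·) 𝓒) (h0 : ∅ ∈ 𝓒)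
    (hx : ∀ t, {i | x i ≤ t} ∈ 𝓒) (hy : ∀ t, {i | y i ≤ t} ∈ 𝓒) (t : ℝ) :
    {i | (x + y) i ≤ t} ∈ 𝓒 := by
  rcases {i | (x + y) i ≤ t}.eq_empty_or_nonempty with he | he
  · rwa [he]
  obtain ⟨i, hi, hmax⟩ := exists_max_sublevel (x + y) he
  -- Since `x` and `y` never order two elements oppositely, an element maximizing `x + y` on the
  -- sublevel set maximizes both summands there.
  have key : {i | (x + y) i ≤ t} = {j | x j ≤ x i} ∩ {j | y j ≤ y i} := by
    ext j
    simp only [mem_ofPred_eq, mem_inter_iff, Pi.add_apply] at hi hmax ⊢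
    refine ⟨fun hj => ?_, fun hj => by linarith⟩
    have hj' := hmax j hj
    constructor <;> by_contra! hlt
    · have := comonotone_of_sublevel h𝓒 hx hy hlt
      linarith
    · have := comonotone_of_sublevel h𝓒 hy hx hlt
      linarith
  rw [key]
  rcases h𝓒.subset_or_subset (hx (x i)) (hy (y i)) with h | h
  · rw [inter_eq_left.2 h]
    exact hx _
  · rw [inter_eq_right.2 h]
    exact hy _

lemma sublevel_const_mem (𝓕 : Set (Set E)) (c t : ℝ) : {_i : E | c ≤ t} ∈ levels 𝓕 := by
  by_cases h : c ≤ t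
  · simpa [h] using univ_mem_levels 𝓕
  · simpa [h] using empty_mem_levels 𝓕

lemma flatVec_mem_flagCone {F : Set E} (hF : F ∈ 𝓕) : flatVec F ∈ flagCone 𝓕 :=
  PointedCone.subset_hull (Or.inl (mem_image_of_mem _ hF))

lemma const_mem_flagCone (𝓕 : Set (Set E)) (c : ℝ) : (fun _ => c) ∈ flagCone 𝓕 := by
  rcases le_total c 0 with hc | hc
  · have : (fun _ : E => c) = (-c) • flatVec univ := by ext; simp [flatVec]
    rw [this]
    exact (flagCone 𝓕).smul_mem (by linarith) (PointedCone.subset_hull (by simp))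
  · have : (fun _ : E => c) = c • (-flatVec univ) := by ext; simp [flatVec]
    rw [this]
    exact (flagCone 𝓕).smul_mem hc (PointedCone.subset_hull (by simp))

lemma sublevel_flatVec_mem {F : Set E} (hF : F ∈ levels 𝓕) (t : ℝ) :
    {i | flatVec F i ≤ t} ∈ levels 𝓕 := by
  rcases le_or_gt 0 t with ht | ht
  · convert univ_mem_levels 𝓕
    ext i
    by_cases hi : i ∈ F <;> simp [flatVec, hi] <;> linarith
  rcases le_or_gt (-1) t with ht' | ht'
  · convert hF
    ext i
    by_cases hi : i ∈ F <;> simp [flatVec, hi] <;> linarith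
  · convert empty_mem_levels 𝓕
    ext i
    by_cases hi : i ∈ F <;> simp [flatVec, hi] <;> linarith

lemma sublevel_mem_of_mem_flagCone [Finite E] (h : IsChain (· ⊆ ·) 𝓕) (hx : x ∈ flagCone 𝓕) :
    ∀ t, {i | x i ≤ t} ∈ levels 𝓕 := by
  refine Submodule.span_induction ?_ ?_ ?_ ?_ hx
  · rintro _ (⟨F, hF, rfl⟩ | rfl | rfl)
    · exact sublevel_flatVec_mem (subset_levels _ hF)
    · exact sublevel_flatVec_mem (univ_mem_levels _)
    · simpa [flatVec] using sublevel_const_mem 𝓕 1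
  · exact fun t => sublevel_const_mem 𝓕 0 t
  · exact fun x y _ _ hx hy => sublevel_add_mem h.levels (empty_mem_levels _) hx hy
  · rintro ⟨a, ha⟩ x - hx t
    rcases eq_or_lt_of_le ha with rfl | ha'
    · simpa using sublevel_const_mem 𝓕 0 t
    · convert hx (t / a) using 3 with i
      change a * x i ≤ t ↔ _
      rw [le_div_iff₀ ha', mul_comm]

/-- If `F` is a proper nonempty sublevel set of `x`, then subtracting a suitable positive multiple
of `flatVec F` from `x` merges two values of `x`. -/
lemma exists_sub_flatVec [Finite E] {F : Set E} {t : ℝ} (hF : {i | x i ≤ t} = F)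
    (h0 : F.Nonempty) (h1 : F ≠ univ) : ∃ a : ℝ, 0 < a ∧
      (∀ s, ∃ s', {i | (x - a • flatVec F) i ≤ s} = {i | x i ≤ s'}) ∧
      (range (x - a • flatVec F)).ncard < (range x).ncard := by
  classical
  obtain ⟨p, hp, hpmax⟩ := exists_max_sublevel x h0
  obtain ⟨q, hq, hqmin⟩ := exists_max_sublevel (-x) (nonempty_compl.2 h1)
  simp only [Pi.neg_apply, neg_le_neg_iff] at hqmin
  have hpq : x p < x q := by
    rw [← hF] at hp hq
    simp only [mem_compl_iff, mem_ofPred_eq, not_le] at hp hq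
    linarith
  have hval : ∀ i, (x - (x q - x p) • flatVec F) i = if i ∈ F then x i + (x q - x p) else x i := by
    intro i
    by_cases hi : i ∈ F <;> simp [flatVec, hi]
    ring
  -- The coefficient is the gap between the largest value on `F` and the smallest value off `F`.
  -- Since `flatVec F` is `-1` on `F`, subtracting raises the values on `F` until those at `p` and
  -- `q` coincide, without reversing any order.
  refine ⟨x q - x p, by linarith, fun s => ?_, ?_⟩
  · rcases lt_or_ge s (x q) with hs | hs
    · refine ⟨s - (x q - x p), ?_⟩
      ext i
      simp only [mem_ofPred_eq, hval]
      split_ifs with hi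
      · rw [le_sub_iff_add_le]
      · have := hqmin i hi
        constructor <;> intro <;> linarith
    · refine ⟨s, ?_⟩
      ext i
      simp only [mem_ofPred_eq, hval]
      split_ifs with hi
      · have := hpmax i hi
        constructor <;> intro <;> linarith
      · rfl
  · let g : ℝ → ℝ := fun v => if v ≤ t then v + (x q - x p) else v
    have hg : x - (x q - x p) • flatVec F = g ∘ x := by
      ext i
      rw [hval, ← hF]
      rfl
    rw [hg, range_comp]
    refine lt_of_le_of_ne (ncard_image_le (toFinite _)) fun h => hpq.ne ?_
    refine (injOn_of_ncard_image_eq h (toFinite _)) (mem_range_self p) (mem_range_self q) ?_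
    rw [← hF] at hp hq
    have hp' : x p ≤ t := hp
    have hq' : ¬ x q ≤ t := hq
    simp [g, hp', hq']

/-- Induction on the number of values of `x`: a nonconstant `x` has a proper nonempty sublevel set,
and removing a multiple of its vector merges two values without creating new sublevel sets.
Constants lie in the lineality space. -/
lemma mem_flagCone_of_sublevel [Finite E] (hx : ∀ t, {i | x i ≤ t} ∈ levels 𝓕) :
    x ∈ flagCone 𝓕 := by
  induction hn : (range x).ncard using Nat.strong_induction_on generalizing x with
  | _ n ih =>
    by_cases hconst : ∀ i j, x i ≤ x j
    · rcases isEmpty_or_nonempty E with hE | ⟨⟨i⟩⟩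
      · rw [Subsingleton.elim x 0]
        exact zero_mem _
      · convert const_mem_flagCone 𝓕 (x i) using 1
        ext j
        exact le_antisymm (hconst _ _) (hconst _ _)
    · push Not at hconst
      obtain ⟨j, i, hij⟩ := hconst
      have h0 : ({k | x k ≤ x i} : Set E).Nonempty := ⟨i, le_refl (x i)⟩
      have h1 : ({k | x k ≤ x i} : Set E) ≠ univ := fun h =>
        absurd (show j ∈ {k | x k ≤ x i} from h ▸ mem_univ j) (not_le.2 hij)
      obtain ⟨a, ha, hlev, hcard⟩ := exists_sub_flatVec rfl h0 h1
      rw [← sub_add_cancel x (a • flatVec {k | x k ≤ x i})]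
      refine add_mem (ih _ (hn ▸ hcard) (fun s => ?_) rfl) ((flagCone 𝓕).smul_mem ha.le
        (flatVec_mem_flagCone (mem_of_mem_levels (hx _) h0.ne_empty h1)))
      obtain ⟨s', hs'⟩ := hlev s
      exact hs' ▸ hx s'

/-- A vector is in the cone of a flag if and only if all its sublevel sets are in the flag. -/
lemma mem_flagCone_iff [Finite E] (h : IsChain (· ⊆ ·) 𝓕) :
    x ∈ flagCone 𝓕 ↔ ∀ t, {i | x i ≤ t} ∈ levels 𝓕 :=
  ⟨sublevel_mem_of_mem_flagCone h, mem_flagCone_of_sublevel⟩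

lemma flagCone_mono (h : 𝓖 ⊆ 𝓕) : flagCone 𝓖 ≤ flagCone 𝓕 :=
  Submodule.span_mono (union_subset_union_left _ (image_mono h))

lemma mem_of_flatVec_mem [Finite E] (h : IsChain (· ⊆ ·) 𝓕) {F : Set E}
    (h0 : F ≠ ∅) (h1 : F ≠ univ) (hF : flatVec F ∈ flagCone 𝓕) : F ∈ 𝓕 := by
  refine mem_of_mem_levels ?_ h0 h1
  convert (mem_flagCone_iff h).1 hF (-1)
  ext i
  by_cases hi : i ∈ F <;> simp [flatVec, hi]

lemma flagCone_le_iff [Finite E] (h : IsChain (· ⊆ ·) 𝓕) (h' : ∀ F ∈ 𝓖, F ≠ ∅ ∧ F ≠ univ) :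
    flagCone 𝓖 ≤ flagCone 𝓕 ↔ 𝓖 ⊆ 𝓕 :=
  ⟨fun hle F hF => mem_of_flatVec_mem h (h' F hF).1 (h' F hF).2 (hle (flatVec_mem_flagCone hF)),
    flagCone_mono⟩

lemma flagCone_inf [Finite E] (h : IsChain (· ⊆ ·) 𝓕) (h' : IsChain (· ⊆ ·) 𝓖) :
    flagCone 𝓕 ⊓ flagCone 𝓖 = flagCone (𝓕 ∩ 𝓖) := by
  ext x
  rw [Submodule.mem_inf, mem_flagCone_iff h, mem_flagCone_iff h',
    mem_flagCone_iff (h.mono inter_subset_left), ← forall_and]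
  refine forall_congr' fun t => ?_
  simp only [levels, mem_insert_iff, mem_inter_iff]
  tauto

/-- By comonotonicity, each nonempty sublevel set of `x` is also a sublevel set of `a • x + y`, so
it is a level of `𝓖`. -/
lemma flagCone_isFaceOf [Finite E] (h : IsChain (· ⊆ ·) 𝓕) (hsub : 𝓖 ⊆ 𝓕) :
    (flagCone 𝓖).IsFaceOf (flagCone 𝓕) := by
  refine ⟨flagCone_mono hsub, fun {x y a} hx hy ha hxy => ?_⟩
  rw [mem_flagCone_iff h] at hx hy
  rw [mem_flagCone_iff (h.mono hsub)] at hxy ⊢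
  intro t
  rcases {i | x i ≤ t}.eq_empty_or_nonempty with he | he
  · exact he ▸ empty_mem_levels _
  obtain ⟨i, hi, hmax⟩ := exists_max_sublevel (a • x + y) he
  convert hxy ((a • x + y) i) using 1
  ext j
  refine ⟨fun hj => hmax j hj, fun hj => ?_⟩
  by_contra! hlt
  have hij : x i < x j := lt_of_le_of_lt hi (not_le.1 hlt)
  have h1 := comonotone_of_sublevel h.levels hx hy hij
  have h2 : a * x j + y j ≤ a * x i + y i := hj
  nlinarith [mul_lt_mul_of_pos_left hij ha]

lemma exists_flag_of_isFaceOf [Finite E] (h : IsChain (· ⊆ ·) 𝓕)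
    {τ : PointedCone ℝ (E → ℝ)} (hτ : τ.IsFaceOf (flagCone 𝓕)) :
    ∃ 𝓖 ⊆ 𝓕, flagCone 𝓖 = τ := by
  -- The face is spanned by the generators it contains. For `x ∈ τ` with a proper nonempty sublevel
  -- set `F`, both `x - a • flatVec F` and `flatVec F` lie in the big cone for some `a > 0`, so the
  -- face property puts `flatVec F` in `τ`.
  refine ⟨{F ∈ 𝓕 | flatVec F ∈ τ}, sep_subset _ _, le_antisymm ?_ fun x hx => ?_⟩
  · have hu : flatVec univ ∈ flagCone 𝓕 := PointedCone.subset_hull (by simp)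
    have hu' : -flatVec univ ∈ flagCone 𝓕 := PointedCone.subset_hull (by simp)
    refine Submodule.span_le.2 ?_
    rintro _ (⟨F, hF, rfl⟩ | rfl | rfl)
    · exact hF.2
    · exact hτ.mem_of_add_mem_left hu hu' (by simp)
    · exact hτ.mem_of_add_mem_right hu hu' (by simp)
  · have hx' := (mem_flagCone_iff h).1 (hτ.le hx)
    rw [mem_flagCone_iff (h.mono (sep_subset _ _))]
    intro t
    by_cases h0 : {i | x i ≤ t} = ∅
    · exact h0 ▸ empty_mem_levels _
    by_cases h1 : {i | x i ≤ t} = univ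
    · exact h1 ▸ univ_mem_levels _
    have hF := mem_of_mem_levels (hx' t) h0 h1
    refine subset_levels _ ⟨hF, ?_⟩
    obtain ⟨a, ha, hlev, -⟩ := exists_sub_flatVec rfl (nonempty_iff_ne_empty.2 h0) h1
    refine hτ.mem_of_smul_add_mem (y := x - a • flatVec {i | x i ≤ t}) (flatVec_mem_flagCone hF)
      ((mem_flagCone_iff h).2 fun s => ?_) ha (by simpa using hx)
    obtain ⟨s', hs'⟩ := hlev s
    exact hs' ▸ hx' s'

/-! ### Span, dimension and tangent space of the cone of a flag. -/

lemma span_flagCone [Finite E] (h : IsChain (· ⊆ ·) 𝓕) :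
    Submodule.span ℝ (flagCone 𝓕 : Set (E → ℝ)) = constOnAtoms ℝ 𝓕 := by
  refine le_antisymm (Submodule.span_le.2 fun x hx i j hij => ?_) ?_
  · have hx := sublevel_mem_of_mem_flagCone h hx
    have key : ∀ i j, atomSetoid 𝓕 i j → x i ≤ x j := by
      intro i j hij
      rcases hx (x j) with h0 | h1 | h2
      · exact absurd (show j ∈ {i | x i ≤ x j} from le_refl (x j)) (by simp [h0])
      · exact show i ∈ {i | x i ≤ x j} from h1 ▸ mem_univ i
      · exact (hij _ h2).2 (le_refl (x j))
    exact le_antisymm (key _ _ hij) (key _ _ ((atomSetoid 𝓕).symm hij))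
  · classical
    rw [constOnAtoms_eq_range]
    rintro _ ⟨g, rfl⟩
    have hmem : ∀ F, F ∈ 𝓕 ∨ F = ∅ ∨ F = univ →
        flatVec F ∈ Submodule.span ℝ (flagCone 𝓕 : Set (E → ℝ)) := by
      rintro F (hF | rfl | rfl)
      · exact Submodule.subset_span (flatVec_mem_flagCone hF)
      · convert zero_mem (Submodule.span ℝ (flagCone 𝓕 : Set (E → ℝ)))
        ext
        simp [flatVec]
      · exact Submodule.subset_span (PointedCone.subset_hull (by simp))
    have := Fintype.ofFinite (Quotient (atomSetoid 𝓕))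
    rw [pi_eq_sum_univ' g, map_sum]
    refine sum_mem fun q _ => ?_
    rw [map_smul]
    refine Submodule.smul_mem _ _ ?_
    induction q using Quotient.inductionOn with
    | _ i =>
    -- The indicator of the atom `upper \ lower` is `flatVec lower - flatVec upper`, because
    -- `flatVec` carries a minus sign.
    convert sub_mem (hmem (lower 𝓕 i) ((lower_mem_or h i).imp_right Or.inl))
      (hmem (upper 𝓕 i) ((upper_mem_or h i).imp_right Or.inr)) using 1
    ext j
    have hq : (Quotient.mk (atomSetoid 𝓕) i = Quotient.mk _ j) ↔ j ∈ upper 𝓕 i ∧ j ∉ lower 𝓕 i :=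
      Quotient.eq.trans atomSetoid_iff_mem
    simp only [LinearMap.funLeft_apply, Pi.single_apply, @eq_comm _ (Quotient.mk _ j), hq,
      Pi.sub_apply, flatVec]
    by_cases h1 : j ∈ upper 𝓕 i
    · by_cases h2 : j ∈ lower 𝓕 i <;> simp [h1, h2]
    · have h2 : j ∉ lower 𝓕 i := fun h2 => h1 (lower_subset_upper h i h2)
      simp [h1, h2]

lemma coneDim_flagCone [Finite E] (h : IsChain (· ⊆ ·) 𝓕) :
    coneDim (flagCone 𝓕) = Nat.card (Quotient (atomSetoid 𝓕)) := by
  rw [coneDim, span_flagCone h, finrank_constOnAtoms]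

lemma tangentZMod2_flagCone [Finite E] (h : IsChain (· ⊆ ·) 𝓕) :
    tangentZMod2 (flagCone 𝓕) = constOnAtoms (ZMod 2) 𝓕 := by
  rw [tangentZMod2, span_flagCone h]
  ext ε
  constructor
  · rintro ⟨z, hz, rfl⟩ i j hij
    have : (z i : ℝ) = z j := hz i j hij
    simp [Int.cast_injective this]
  · intro hε
    refine ⟨fun i => (ε i).val, fun i j hij => by simp [hε i j hij], ?_⟩
    ext i
    simp

lemma exists_integral_generators [Finite E] (𝓕 : Set (Set E)) : ∃ S : Finset (E → ℤ),
    flagCone 𝓕 = PointedCone.hull ℝ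
      ((fun (z : E → ℤ) (i : E) => (z i : ℝ)) '' (S : Set (E → ℤ))) := by
  let v : Set E → E → ℤ := fun F => F.indicator fun _ => -1
  have hv : ∀ F, (fun i => (v F i : ℝ)) = flatVec F := by
    intro F
    ext i
    by_cases hi : i ∈ F <;> simp [v, flatVec, hi]
  have hfin : (v '' 𝓕 ∪ {v univ, -v univ}).Finite := toFinite _
  refine ⟨hfin.toFinset, ?_⟩
  rw [Finite.coe_toFinset, flagCone, image_union, image_pair, image_image]
  simp only [hv]
  congr
  rw [← hv univ]
  ext i
  simp

/-- The affine matroid fan is a rational polyhedral fan. -/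
lemma matroidFan_isRationalFan [Finite E] (M : Matroid E) : IsRationalFan (matroidFan M) where
  finite := by
    have : matroidFan M = flagCone '' {𝓕 | IsFlag M 𝓕} := rfl
    rw [this]
    exact toFinite _
  rational := by
    rintro _ ⟨𝓕, -, rfl⟩
    exact exists_integral_generators 𝓕
  face_mem := by
    rintro _ ⟨𝓕, h𝓕, rfl⟩ τ hτ
    obtain ⟨𝓖, hsub, rfl⟩ := exists_flag_of_isFaceOf h𝓕.2 hτ
    exact ⟨𝓖, ⟨fun F hF => h𝓕.1 F (hsub hF), h𝓕.2.mono hsub⟩, rfl⟩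
  inter := by
    rintro _ ⟨𝓕, h𝓕, rfl⟩ _ ⟨𝓖, h𝓖, rfl⟩
    rw [flagCone_inf h𝓕.2 h𝓖.2]
    exact ⟨flagCone_isFaceOf h𝓕.2 inter_subset_left, flagCone_isFaceOf h𝓖.2 inter_subset_right⟩

lemma IsFlag.flagCone_le_iff [Finite E] {M : Matroid E} (h𝓖 : IsFlag M 𝓖) (h𝓕 : IsFlag M 𝓕) :
    flagCone 𝓖 ≤ flagCone 𝓕 ↔ 𝓖 ⊆ 𝓕 := _root_.flagCone_le_iff h𝓕.2 fun F hF => (h𝓖.1 F hF).2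

lemma IsFlag.flagCone_injective [Finite E] {M : Matroid E} (h𝓖 : IsFlag M 𝓖) (h𝓕 : IsFlag M 𝓕)
    (h : flagCone 𝓖 = flagCone 𝓕) : 𝓖 = 𝓕 :=
  Subset.antisymm ((h𝓖.flagCone_le_iff h𝓕).1 h.le) ((h𝓕.flagCone_le_iff h𝓖).1 h.ge)

/-- The facets of the affine matroid fan are the cones of the maximal flags. -/
lemma mem_facets_matroidFan [Finite E] {M : Matroid E} {σ : PointedCone ℝ (E → ℝ)} :
    σ ∈ facets (matroidFan M) ↔ ∃ 𝓕, Maximal (IsFlag M) 𝓕 ∧ flagCone 𝓕 = σ := by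
  constructor
  · rintro ⟨⟨𝓕, h𝓕, rfl⟩, hmax⟩
    exact ⟨𝓕, ⟨h𝓕, fun 𝓖 h𝓖 hle => (h𝓖.flagCone_le_iff h𝓕).1
      (hmax ⟨𝓖, h𝓖, rfl⟩ (flagCone_mono hle))⟩, rfl⟩
  · rintro ⟨𝓕, h𝓕, rfl⟩
    refine ⟨⟨𝓕, h𝓕.1, rfl⟩, ?_⟩
    rintro _ ⟨𝓖, h𝓖, rfl⟩ hle
    exact flagCone_mono (h𝓕.2 h𝓖 ((h𝓕.1.flagCone_le_iff h𝓖).1 hle))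

end Cones

/-! ### Flags of flats -/

section Flags

variable {E : Type*} {M : Matroid E} {𝓖 : Set (Set E)} {G G' H : Set E}

lemma IsFlag.mono {𝓕 : Set (Set E)} (h : IsFlag M 𝓕) (hsub : 𝓖 ⊆ 𝓕) : IsFlag M 𝓖 :=
  ⟨fun F hF => h.1 F (hsub hF), h.2.mono hsub⟩

lemma IsFlag.insert (h : IsFlag M 𝓖) (hH : M.IsFlat H) (h0 : H ≠ ∅) (h1 : H ≠ univ)
    (hcomp : ∀ A ∈ 𝓖, A ⊆ H ∨ H ⊆ A) : IsFlag M (insert H 𝓖) := by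
  refine ⟨?_, h.2.insert fun A hA _ => (hcomp A hA).symm⟩
  rintro A (rfl | hA)
  exacts [⟨hH, h0, h1⟩, h.1 A hA]

lemma mem_of_maximal_isFlag (h : Maximal (IsFlag M) 𝓖) (hH : M.IsFlat H) (h0 : H ≠ ∅)
    (h1 : H ≠ univ) (hcomp : ∀ A ∈ 𝓖, A ⊆ H ∨ H ⊆ A) : H ∈ 𝓖 :=
  h.2 (h.1.insert hH h0 h1 hcomp) (subset_insert _ _) (mem_insert _ _)

/-- `G ⊂ G'` is a gap of `𝓖` if no member of `𝓖` lies strictly between `G` and `G'` or is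
incomparable to these. -/
structure IsGap (𝓖 : Set (Set E)) (G G' : Set E) : Prop where
  left : G ∈ 𝓖 ∨ G = ∅
  right : G' ∈ 𝓖 ∨ G' = univ
  subset_or : ∀ A ∈ 𝓖, A ⊆ G ∨ G' ⊆ A

lemma IsGap.notMem (h : IsGap 𝓖 G G') (hG : G ⊂ H) (hG' : H ⊂ G') : H ∉ 𝓖 := fun hH =>
  (h.subset_or H hH).elim hG.not_subset hG'.not_subset

lemma IsGap.ne_empty (hG : G ⊂ H) : H ≠ ∅ := (nonempty_of_ssubset' hG).ne_empty

lemma IsGap.insert_isFlag (h : IsGap 𝓖 G G') (h𝓖 : IsFlag M 𝓖) (hH : M.IsFlat H)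
    (hG : G ⊂ H) (hG' : H ⊂ G') : IsFlag M (insert H 𝓖) :=
  h𝓖.insert hH (IsGap.ne_empty hG) (ssubset_univ_iff.1 (hG'.trans_subset (subset_univ _)))
    fun A hA => (h.subset_or A hA).imp (fun h => h.trans hG.subset) fun h => hG'.subset.trans h

lemma exists_isGap [Finite E] (h𝓖 : IsChain (· ⊆ ·) 𝓖) (h0 : H ≠ ∅) (h1 : H ≠ univ)
    (hH : H ∉ 𝓖) (hcomp : ∀ A ∈ 𝓖, A ⊆ H ∨ H ⊆ A) :
    ∃ G G', IsGap 𝓖 G G' ∧ G ⊂ H ∧ H ⊂ G' := by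
  have hl : ⋃₀ {A ∈ 𝓖 | A ⊆ H} ∈ 𝓖 ∨ ⋃₀ {A ∈ 𝓖 | A ⊆ H} = ∅ := by
    rcases {A ∈ 𝓖 | A ⊆ H}.eq_empty_or_nonempty with he | he
    · exact Or.inr (by rw [he, sUnion_empty])
    · exact Or.inl ((h𝓖.mono (sep_subset _ _)).sUnion_mem he).1
  have hr : ⋂₀ {A ∈ 𝓖 | H ⊆ A} ∈ 𝓖 ∨ ⋂₀ {A ∈ 𝓖 | H ⊆ A} = univ := by
    rcases {A ∈ 𝓖 | H ⊆ A}.eq_empty_or_nonempty with he | he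
    · exact Or.inr (by rw [he, sInter_empty])
    · exact Or.inl ((h𝓖.mono (sep_subset _ _)).sInter_mem he).1
  refine ⟨_, _, ⟨hl, hr, fun A hA => (hcomp A hA).imp (fun h => subset_sUnion_of_mem ⟨hA, h⟩)
    fun h => sInter_subset_of_mem ⟨hA, h⟩⟩, ?_, ?_⟩
  · refine (sUnion_subset fun A hA => hA.2).ssubset_of_ne fun h => ?_
    rw [h] at hl
    exact hl.elim hH h0
  · refine (subset_sInter fun A hA => hA.2).ssubset_of_ne fun h => ?_
    rw [← h] at hr
    exact hr.elim hH h1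

end Flags

/-! ### Covectors, topes and flats. -/

namespace OrientedMatroid

open SignVec

variable {E : Type*} {O : OrientedMatroid E}

lemma _root_.SignVec.comp_of_eq_zero {X Y : E → SignType} {i : E} (h : X i = 0) :
    comp X Y i = Y i := if_pos h

lemma _root_.SignVec.comp_of_ne_zero {X Y : E → SignType} {i : E} (h : X i ≠ 0) :
    comp X Y i = X i := if_neg h

lemma _root_.SignVec.erase_of_mem {T : E → SignType} {F : Set E} {i : E} (h : i ∈ F) :
    erase T F i = 0 := if_pos h

lemma _root_.SignVec.erase_of_notMem {T : E → SignType} {F : Set E} {i : E} (h : i ∉ F) :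
    erase T F i = T i := if_neg h

lemma _root_.SignVec.erase_empty (T : E → SignType) : erase T ∅ = T := by
  ext i
  rw [erase_of_notMem (notMem_empty i)]

lemma _root_.SignVec.erase_univ (T : E → SignType) : erase T univ = 0 := by
  ext i
  rw [erase_of_mem (mem_univ i), Pi.zero_apply]

lemma _root_.SignType.ne_neg_self {a : SignType} (h : a ≠ 0) : a ≠ -a := by
  revert a
  decide

lemma _root_.SignType.eq_neg_of_ne {a b : SignType} (ha : a ≠ 0) (hb : b ≠ 0) (h : a ≠ b) :
    a = -b := by
  revert a b
  decide

/-- Covector elimination, in a form that separates the cases. -/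
lemma exists_elim {X Y : E → SignType} (hX : X ∈ O.covectors) (hY : Y ∈ O.covectors) {j : E}
    (hj : X j = -Y j) (hj0 : X j ≠ 0) : ∃ Z ∈ O.covectors, Z j = 0 ∧
      (∀ k, X k = 0 → Z k = Y k) ∧ ∀ k, X k ≠ 0 → X k ≠ -Y k → Z k = X k := by
  obtain ⟨Z, hZ, hZj, h⟩ := O.elim X hX Y hY j ⟨hj, hj0⟩
  refine ⟨Z, hZ, hZj, fun k hk => ?_, fun k hk hk' => ?_⟩
  · rw [h k fun hs => hs.2 hk, comp_of_eq_zero hk]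
  · rw [h k fun hs => hk' hs.1, comp_of_ne_zero hk]

lemma isTope_of_ne_zero {T : E → SignType} (h : T ∈ O.covectors) (h0 : ∀ i, T i ≠ 0) :
    O.IsTope T :=
  ⟨h, fun _ _ hle => funext fun i => ((hle i).resolve_left (h0 i)).symm⟩

lemma erase_mem_of_mem_adjacentTopes {𝓕 : Set (Set E)} {T : E → SignType}
    (hT : T ∈ O.adjacentTopes 𝓕) {F : Set E} (hF : F ∈ 𝓕 ∨ F = ∅) : erase T F ∈ O.covectors := by
  rcases hF with hF | rfl
  · exact hT.2 F hF
  · rw [erase_empty]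
    exact hT.1.1

lemma mem_adjacentTopes_insert {𝓖 : Set (Set E)} {T : E → SignType}
    (hT : T ∈ O.adjacentTopes 𝓖) {H : Set E} (hH : erase T H ∈ O.covectors) :
    T ∈ O.adjacentTopes (insert H 𝓖) := by
  refine ⟨hT.1, ?_⟩
  rintro F (rfl | hF)
  exacts [hH, hT.2 F hF]

lemma adjacentTopes_anti {𝓖 𝓕 : Set (Set E)} (h : 𝓖 ⊆ 𝓕) :
    O.adjacentTopes 𝓕 ⊆ O.adjacentTopes 𝓖 := fun _ hT => ⟨hT.1, fun F hF => hT.2 F (h hF)⟩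

lemma erase_mem_of_isGap {𝓖 : Set (Set E)} {T : E → SignType} (hT : T ∈ O.adjacentTopes 𝓖)
    {G G' : Set E} (h : IsGap 𝓖 G G') : erase T G ∈ O.covectors ∧ erase T G' ∈ O.covectors := by
  refine ⟨erase_mem_of_mem_adjacentTopes hT h.left, ?_⟩
  rcases h.right with h | rfl
  · exact hT.2 _ h
  · rw [erase_univ]
    exact O.zero_mem

section Basic

variable [Finite E]

lemma isFlat_iff_cl {F : Set E} : O.toMatroid.IsFlat F ↔ O.cl F = F := by
  rw [Matroid.isFlat_iff_closure_eq, toMatroid_closure]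

lemma isFlat_cl (A : Set E) : O.toMatroid.IsFlat (O.cl A) := by
  rw [← toMatroid_closure]
  exact Matroid.isFlat_closure _

lemma exists_covector_of_isFlat {F : Set E} (h : O.toMatroid.IsFlat F) :
    ∃ X ∈ O.covectors, ∀ i, X i = 0 ↔ i ∈ F := by
  obtain ⟨X, hX, rfl⟩ := (O.isFlat_iff F).1 h
  exact ⟨X, hX, fun i => Iff.rfl⟩

lemma Loopfree.isFlat_empty (h : O.Loopfree) : O.toMatroid.IsFlat ∅ := by
  rw [Matroid.isFlat_iff_closure_eq]
  exact h.loops_eq_empty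

lemma isFlat_of_erase_mem {T : E → SignType} (hT : ∀ i, T i ≠ 0) {F : Set E}
    (h : erase T F ∈ O.covectors) : O.toMatroid.IsFlat F := by
  refine (O.isFlat_iff F).2 ⟨_, h, ?_⟩
  ext i
  by_cases hi : i ∈ F
  · simp [erase_of_mem hi, hi]
  · simp [erase_of_notMem hi, hi, hT i]

/-- As `∅` is a flat, some covector is nowhere zero. Composing a tope with it gives a larger
covector, which by maximality is the tope itself. -/
lemma IsTope.ne_zero (hO : O.Loopfree) {T : E → SignType} (h : O.IsTope T) (i : E) : T i ≠ 0 := by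
  obtain ⟨X, hX, hX0⟩ := exists_covector_of_isFlat hO.isFlat_empty
  have := h.2 _ (O.comp_mem T h.1 X hX) fun j => by
    by_cases hj : T j = 0
    · exact Or.inl hj
    · exact Or.inr (comp_of_ne_zero hj).symm
  intro hi
  exact (hX0 i).1 ((comp_of_eq_zero hi).symm.trans ((congrFun this i).trans hi))

lemma exists_tope (hO : O.Loopfree) : ∃ T ∈ O.covectors, ∀ i, T i ≠ 0 := by
  obtain ⟨X, hX, hX0⟩ := exists_covector_of_isFlat hO.isFlat_empty
  exact ⟨X, hX, fun i hi => (hX0 i).1 hi⟩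

lemma _root_.lower_mem_insert {𝓕 : Set (Set E)} (h : IsChain (· ⊆ ·) 𝓕) (i : E) :
    lower 𝓕 i ∈ insert ∅ 𝓕 := (lower_mem_or h i).symm

lemma isFlat_lower (hO : O.Loopfree) {𝓕 : Set (Set E)} (h : IsFlag O.toMatroid 𝓕) (i : E) :
    O.toMatroid.IsFlat (lower 𝓕 i) := by
  rcases lower_mem_or h.2 i with hi | hi
  · exact (h.1 _ hi).1
  · exact hi ▸ hO.isFlat_empty

lemma isFlat_upper {𝓕 : Set (Set E)} (h : IsFlag O.toMatroid 𝓕) (i : E) :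
    O.toMatroid.IsFlat (upper 𝓕 i) := by
  rcases upper_mem_or h.2 i with hi | hi
  · exact (h.1 _ hi).1
  · exact hi ▸ O.toMatroid.ground_isFlat

/-! ### Topes adjacent to a flag -/

/-- Covectors `X F` that vanish on the members `F` of a chain can be glued along the chain. -/
lemma erase_mem_of_glue {𝓕 : Set (Set E)} (h𝓕 : IsChain (· ⊆ ·) 𝓕) {X : Set E → E → SignType}
    (hX : ∀ F ∈ insert ∅ 𝓕, X F ∈ O.covectors ∧ ∀ i ∈ F, X F i = 0) {T : E → SignType}
    (hT : ∀ i, T i ≠ 0) (hTX : ∀ i, T i = X (lower 𝓕 i) i) :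
    ∀ F ∈ insert ∅ 𝓕, erase T F ∈ O.covectors := by
  intro F
  induction F using WellFoundedGT.induction with
  | _ F ih =>
  intro hF
  -- Descending induction: `G` is the next member above `F`, or `univ`, and `T \ F = (T \ G) ∘ X F`,
  -- since `lower` equals `F` on `G \ F`.
  obtain ⟨G, hFG, hG, hGmin⟩ : ∃ G, F ⊆ G ∧ erase T G ∈ O.covectors ∧
      ∀ A ∈ 𝓕, F ⊂ A → G ⊆ A := by
    rcases {A ∈ 𝓕 | F ⊂ A}.eq_empty_or_nonempty with he | he
    · refine ⟨univ, subset_univ _, ?_, fun A hA hFA => ?_⟩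
      · rw [erase_univ]
        exact O.zero_mem
      · exact absurd (show A ∈ {A ∈ 𝓕 | F ⊂ A} from ⟨hA, hFA⟩) (by simp [he])
    · have hm := (h𝓕.mono (sep_subset _ _)).sInter_mem he
      exact ⟨_, hm.2.subset, ih _ hm.2 (mem_insert_of_mem _ hm.1),
        fun A hA hFA => sInter_subset_of_mem ⟨hA, hFA⟩⟩
  convert O.comp_mem _ hG _ (hX F hF).1 using 1
  ext i
  by_cases hiG : i ∈ G
  · rw [comp_of_eq_zero (erase_of_mem hiG)]
    by_cases hiF : i ∈ F
    · rw [erase_of_mem hiF, (hX F hF).2 i hiF]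
    · have hlow : lower 𝓕 i = F := by
        have hFi : F ⊆ lower 𝓕 i := by
          rcases hF with rfl | hF
          exacts [empty_subset _, subset_lower hF hiF]
        refine (hFi.eq_of_not_ssubset fun hss => ?_).symm
        rcases lower_mem_or h𝓕 i with h | h
        · exact notMem_lower 𝓕 i (hGmin _ h hss hiG)
        · rw [h] at hss
          exact hss.not_subset (empty_subset _)
      rw [erase_of_notMem hiF, hTX i, hlow]
  · rw [erase_of_notMem fun hiF => hiG (hFG hiF), comp_of_ne_zero, erase_of_notMem hiG]
    rw [erase_of_notMem hiG]
    exact hT i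

lemma mem_adjacentTopes_of_glue {𝓕 : Set (Set E)} (h𝓕 : IsChain (· ⊆ ·) 𝓕)
    {X : Set E → E → SignType}
    (hX : ∀ F ∈ insert ∅ 𝓕, X F ∈ O.covectors ∧ ∀ i ∈ F, X F i = 0) {T : E → SignType}
    (hT : ∀ i, T i ≠ 0) (hTX : ∀ i, T i = X (lower 𝓕 i) i) : T ∈ O.adjacentTopes 𝓕 := by
  have h := erase_mem_of_glue h𝓕 hX hT hTX
  refine ⟨isTope_of_ne_zero ?_ hT, fun F hF => h F (mem_insert_of_mem _ hF)⟩
  rw [← erase_empty T]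
  exact h ∅ (mem_insert _ _)

lemma adjacentTopes_nonempty (hO : O.Loopfree) {𝓕 : Set (Set E)} (h𝓕 : IsFlag O.toMatroid 𝓕) :
    (O.adjacentTopes 𝓕).Nonempty := by
  have hex : ∀ F : Set E, ∃ X, F ∈ insert ∅ 𝓕 → X ∈ O.covectors ∧ ∀ i, X i = 0 ↔ i ∈ F := by
    intro F
    by_cases hF : F ∈ insert ∅ 𝓕
    · obtain ⟨X, hX⟩ := exists_covector_of_isFlat (O := O) (F := F) (by
        rcases hF with rfl | hF
        exacts [hO.isFlat_empty, (h𝓕.1 F hF).1])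
      exact ⟨X, fun _ => hX⟩
    · exact ⟨0, fun h => absurd h hF⟩
  choose X hX using hex
  exact ⟨fun i => X (lower 𝓕 i) i, mem_adjacentTopes_of_glue h𝓕.2
    (fun F hF => ⟨(hX F hF).1, fun i hi => ((hX F hF).2 i).2 hi⟩)
    (fun i hi => notMem_lower 𝓕 i (((hX _ (lower_mem_insert h𝓕.2 i)).2 i).1 hi)) fun i => rfl⟩

/-- Changing the signs of an adjacent tope on some atoms of the flag gives an adjacent tope. -/
lemma mem_adjacentTopes_of_agree (hO : O.Loopfree) {𝓕 : Set (Set E)} (h𝓕 : IsChain (· ⊆ ·) 𝓕)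
    {T T' : E → SignType} (hT : T ∈ O.adjacentTopes 𝓕) (hT' : ∀ i, T' i ≠ 0)
    (h : ∀ i j, atomSetoid 𝓕 i j → T' i = T i → T' j = T j) : T' ∈ O.adjacentTopes 𝓕 := by
  classical
  have hlow : ∀ {i j}, lower 𝓕 i = lower 𝓕 j → atomSetoid 𝓕 i j := by
    intro i j hij F hF
    constructor <;> intro hi <;> by_contra hj
    · exact notMem_lower 𝓕 i (hij ▸ subset_lower hF hj hi)
    · exact notMem_lower 𝓕 j (hij ▸ subset_lower hF hj hi)
  -- Each `F` is the `lower` of at most one atom, and `T'` is `T` or `-T` throughout that atom. The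
  -- sign of `T \ F` is chosen accordingly.
  refine mem_adjacentTopes_of_glue h𝓕
    (X := fun F => if ∃ i, lower 𝓕 i = F ∧ T' i = T i then erase T F else -erase T F)
    (fun F hF => ?_) hT' fun i => ?_
  · have hmem := erase_mem_of_mem_adjacentTopes hT (F := F) hF.symm
    split_ifs
    · exact ⟨hmem, fun i hi => erase_of_mem hi⟩
    · exact ⟨O.neg_mem _ hmem, fun i hi => by rw [Pi.neg_apply, erase_of_mem hi, neg_zero]⟩
  · have hi := erase_of_notMem (T := T) (notMem_lower 𝓕 i)
    split_ifs with hex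
    · obtain ⟨j, hj, hTj⟩ := hex
      rw [hi]
      exact h j i (hlow hj) hTj
    · rw [Pi.neg_apply, hi]
      exact SignType.eq_neg_of_ne (hT' i) (hT.1.ne_zero hO i) fun h => hex ⟨i, rfl, h⟩

/-- In a maximal flag, the atom of `j` is contained in the closure of `j` and the flat below. -/
lemma mem_cl_of_atom {𝓕 : Set (Set E)} (h𝓕 : Maximal (IsFlag O.toMatroid) 𝓕)
    {i j : E} (hij : atomSetoid 𝓕 j i) : i ∈ O.cl (insert j (lower 𝓕 j)) := by
  by_contra hi
  have hj : j ∈ O.cl (insert j (lower 𝓕 j)) := subset_cl _ (mem_insert _ _)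
  have hup : O.cl (insert j (lower 𝓕 j)) ⊆ upper 𝓕 j := by
    rw [← isFlat_iff_cl.1 (isFlat_upper h𝓕.1 j)]
    exact cl_mono (insert_subset (mem_upper 𝓕 j) (lower_subset_upper h𝓕.1.2 j))
  -- The closure lies between `lower 𝓕 j` and `upper 𝓕 j`, so it is comparable with every member.
  -- Unless it is `univ`, maximality puts it in the flag, where it cannot separate `j` from `i`.
  have hmem := mem_of_maximal_isFlag h𝓕 (isFlat_cl (insert j (lower 𝓕 j)))
    (nonempty_of_mem hj).ne_empty (fun h => hi (h ▸ mem_univ i)) fun A hA => by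
      by_cases hjA : j ∈ A
      · exact Or.inr (hup.trans (upper_subset hA hjA))
      · exact Or.inl ((subset_lower hA hjA).trans ((subset_insert _ _).trans (subset_cl _)))
  exact hi ((hij _ hmem).1 hj)

lemma eq_zero_of_atom {𝓕 : Set (Set E)} (h𝓕 : Maximal (IsFlag O.toMatroid) 𝓕) {i j : E}
    (hij : atomSetoid 𝓕 j i) {Z : E → SignType} (hZ : Z ∈ O.covectors)
    (hlow : ∀ k ∈ lower 𝓕 j, Z k = 0) (hj : Z j = 0) : Z i = 0 := by
  refine mem_cl_of_atom h𝓕 hij Z hZ ?_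
  rintro k (rfl | hk)
  exacts [hj, hlow k hk]

/-- On each atom of a maximal flag, two adjacent topes agree up to sign. -/
lemma agree_of_mem_adjacentTopes (hO : O.Loopfree) {𝓕 : Set (Set E)}
    (h𝓕 : Maximal (IsFlag O.toMatroid) 𝓕) {T T' : E → SignType} (hT : T ∈ O.adjacentTopes 𝓕)
    (hT' : T' ∈ O.adjacentTopes 𝓕) {i j : E} (hij : atomSetoid 𝓕 i j) (h : T' i = T i) :
    T' j = T j := by
  by_contra hne
  have hj := SignType.eq_neg_of_ne (hT'.1.ne_zero hO j) (hT.1.ne_zero hO j) hne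
  have hlow := lower_eq_of_atom hij
  have hi0 : i ∉ lower 𝓕 j := hlow ▸ notMem_lower 𝓕 i
  have hj0 : j ∉ lower 𝓕 j := notMem_lower 𝓕 j
  have hmem := lower_mem_or h𝓕.1.2 j
  -- If `T'` agrees with `T` at `i` and opposes it at `j`, eliminating `j` gives a covector that
  -- vanishes on the flat below and at `j`, but not at `i`.
  obtain ⟨Z, hZ, hZj, hZ0, hZ1⟩ := exists_elim (j := j) (erase_mem_of_mem_adjacentTopes hT' hmem)
    (erase_mem_of_mem_adjacentTopes hT hmem)
    (by rw [erase_of_notMem hj0, erase_of_notMem hj0, hj])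
    (by rw [erase_of_notMem hj0]; exact hT'.1.ne_zero hO j)
  have hZi : Z i = T' i := by
    rw [hZ1 i, erase_of_notMem hi0]
    · rw [erase_of_notMem hi0]
      exact hT'.1.ne_zero hO i
    · rw [erase_of_notMem hi0, erase_of_notMem hi0, h]
      exact SignType.ne_neg_self (hT.1.ne_zero hO i)
  refine hT'.1.ne_zero hO i (hZi ▸ eq_zero_of_atom h𝓕 ((atomSetoid 𝓕).symm hij) hZ
    (fun k hk => ?_) hZj)
  rw [hZ0 k (erase_of_mem hk), erase_of_mem hk]

/-! ### Maximal flags have the same number of atoms -/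

/-- A covector vanishing on the representatives vanishes on each atom as soon as it vanishes on the
flat below, so it vanishes everywhere by climbing the flag. -/
lemma cl_atomReps {𝓕 : Set (Set E)} (h𝓕 : Maximal (IsFlag O.toMatroid) 𝓕) :
    O.cl (atomReps 𝓕) = univ := by
  refine eq_univ_of_forall fun i X hX h0 => ?_
  induction hF : lower 𝓕 i using WellFoundedLT.induction generalizing i with
  | _ F ih =>
  obtain ⟨j, hj, hji⟩ := exists_mem_atomReps 𝓕 i
  refine eq_zero_of_atom h𝓕 hji hX (fun k hk => ?_) (h0 j hj)
  rw [lower_eq_of_atom hji] at hk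
  refine ih (lower 𝓕 k) ?_ k rfl
  rw [← hF]
  refine ⟨?_, fun hle => notMem_lower 𝓕 k (hle hk)⟩
  rcases lower_mem_or h𝓕.1.2 i with h | h
  · exact (lower_subset_upper h𝓕.1.2 k).trans (upper_subset h hk)
  · rw [h] at hk
    exact hk.elim

/-- Going up the flag, each step adds one representative, which lies outside the flat spanning the
earlier ones' closure. -/
lemma indep_atomReps (hO : O.Loopfree) {𝓕 : Set (Set E)} (h𝓕 : IsFlag O.toMatroid 𝓕) :
    O.Indep (atomReps 𝓕) := by
  have key : ∀ F : Set E, (F ∈ 𝓕 ∨ F = univ) ∨ F = ∅ → O.Indep (atomReps 𝓕 ∩ F) := by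
    intro F
    induction F using WellFoundedLT.induction with
    | _ F ih =>
    intro hF
    rcases F.eq_empty_or_nonempty with rfl | hne
    · rw [inter_empty]
      exact fun e he => he.elim
    obtain ⟨i, hiF, hi⟩ := exists_upper_eq h𝓕.2 (hF.resolve_right hne.ne_empty) hne
    obtain ⟨j, hj, hji⟩ := exists_mem_atomReps 𝓕 i
    rw [← upper_eq_of_atom hji] at hi
    have hss : lower 𝓕 j ⊂ F := by
      rw [← hi]
      exact ⟨lower_subset_upper h𝓕.2 j, fun h => notMem_lower 𝓕 j (h (mem_upper 𝓕 j))⟩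
    have heq : atomReps 𝓕 ∩ F = insert j (atomReps 𝓕 ∩ lower 𝓕 j) := by
      ext k
      constructor
      · rintro ⟨hk, hkF⟩
        by_cases hkl : k ∈ lower 𝓕 j
        · exact Or.inr ⟨hk, hkl⟩
        · exact Or.inl (eq_of_mem_atomReps hj hk (atomSetoid_iff_mem.2 ⟨hi ▸ hkF, hkl⟩)).symm
      · rintro (rfl | ⟨hk, hkl⟩)
        · exact ⟨hj, hi ▸ mem_upper 𝓕 k⟩
        · exact ⟨hk, hss.subset hkl⟩
    rw [heq]
    refine (ih _ hss ((lower_mem_or h𝓕.2 j).imp_left Or.inl)).insert_of_notMem fun hcl => ?_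
    have := cl_mono inter_subset_right hcl
    rw [isFlat_iff_cl.1 (isFlat_lower hO h𝓕 j)] at this
    exact notMem_lower 𝓕 j this
  simpa using key univ (Or.inl (Or.inr rfl))

lemma card_atoms_le (hO : O.Loopfree) {𝓕 𝓖 : Set (Set E)} (h𝓕 : IsFlag O.toMatroid 𝓕)
    (h𝓖 : Maximal (IsFlag O.toMatroid) 𝓖) :
    Nat.card (Quotient (atomSetoid 𝓕)) ≤ Nat.card (Quotient (atomSetoid 𝓖)) := by
  rw [← ncard_atomReps, ← ncard_atomReps]
  exact Indep.ncard_le _ _ rfl (indep_atomReps hO h𝓕) (cl_atomReps h𝓖 ▸ subset_univ _)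

lemma card_atoms_eq (hO : O.Loopfree) {𝓕 𝓖 : Set (Set E)}
    (h𝓕 : Maximal (IsFlag O.toMatroid) 𝓕) (h𝓖 : Maximal (IsFlag O.toMatroid) 𝓖) :
    Nat.card (Quotient (atomSetoid 𝓕)) = Nat.card (Quotient (atomSetoid 𝓖)) :=
  le_antisymm (card_atoms_le hO h𝓕.1 h𝓖) (card_atoms_le hO h𝓖.1 h𝓕)

/-! ### Walls of topes -/

/-- If `T \ G` and `T \ G'` are covectors and `Y` is a covector that vanishes on `G`, has a zero
in `G' \ G`, and differs from `T` at some nonzero entry in `G'`, then there is a flat `H` strictly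
between `G` and `G'` such that `T \ H` is a covector, and `Y` differs from `T` on `H \ G`. -/
lemma exists_wall {T : E → SignType} (hT : ∀ i, T i ≠ 0) {G G' : Set E}
    (hG : erase T G ∈ O.covectors) (hG' : erase T G' ∈ O.covectors) (hGG' : G ⊆ G')
    {Y : E → SignType} (hY : Y ∈ O.covectors) (hYG : ∀ i ∈ G, Y i = 0)
    (ha : ∃ a ∈ G', a ∉ G ∧ Y a = 0) (hb : ∃ b ∈ G', Y b = -T b) :
    ∃ H, G ⊂ H ∧ H ⊂ G' ∧ erase T H ∈ O.covectors ∧ ∀ i ∈ H, i ∉ G → Y i = -T i := by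
  induction hn : {i | Y i = -T i}.ncard using Nat.strong_induction_on generalizing Y with
  | _ n ih =>
  obtain ⟨b, hbG', hYb⟩ := hb
  have hTb := hT b
  have hbG : b ∉ G := fun h => hTb (by simpa [hYG b h] using hYb.symm)
  -- Eliminating `b` turns `Y` into a covector `Z` that equals `T` off `G` wherever `Y` did not
  -- oppose `T`. The opposition set shrinks, and `b` is the zero required for the induction.
  obtain ⟨Z, hZ, hZb, hZ0, hZ1⟩ := exists_elim (j := b) hG hY
    (by rw [erase_of_notMem hbG, hYb, neg_neg]) (by rwa [erase_of_notMem hbG])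
  have hZG : ∀ i ∈ G, Z i = 0 := fun i hi => by rw [hZ0 i (erase_of_mem hi), hYG i hi]
  have hZT : ∀ i ∉ G, Y i ≠ -T i → Z i = T i := by
    intro i hi hne
    rw [hZ1 i, erase_of_notMem hi]
    · rw [erase_of_notMem hi]
      exact hT i
    · rw [erase_of_notMem hi]
      exact fun h => hne (by rw [h, neg_neg])
  have hYZ : ∀ i ∉ G, Z i ≠ T i → Y i = -T i := fun i hi hne => by
    by_contra h
    exact hne (hZT i hi h)
  have hsub : ∀ i, Z i = -T i → Y i = -T i := by
    intro i hi
    refine hYZ i (fun hiG => hT i ?_) fun h => SignType.ne_neg_self (hT i) (h ▸ hi)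
    simpa [hZG i hiG] using hi.symm
  by_cases hc : ∃ c ∈ G', Z c = -T c
  · have hlt : {i | Z i = -T i} ⊂ {i | Y i = -T i} := by
      refine ⟨hsub, fun h => hTb ?_⟩
      have : Z b = -T b := h hYb
      rw [hZb] at this
      simpa using this.symm
    obtain ⟨H, h1, h2, h3, h4⟩ := ih _ (hn ▸ ncard_lt_ncard hlt) hZ hZG ⟨b, hbG', hbG, hZb⟩ hc rfl
    exact ⟨H, h1, h2, h3, fun i hi hiG => hsub i (h4 i hi hiG)⟩
  · push Not at hc
    obtain ⟨a, haG', haG, hYa⟩ := ha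
    -- With no opposition left in `G'`, the wall is the zero set of `Z` in `G'`, and `T \ H = (T \
    -- G') ∘ Z`. It misses `a`, because `Y a = 0` forces `Z a = T a`.
    refine ⟨{i ∈ G' | Z i = 0}, ⟨fun i hi => ⟨hGG' hi, hZG i hi⟩, fun h => hbG (h ⟨hbG', hZb⟩)⟩,
      ⟨sep_subset _ _, fun h => hT a ?_⟩, ?_, fun i hi hiG => hYZ i hiG ?_⟩
    · rw [← hZT a haG, (h haG').2]
      rw [hYa]
      exact fun h => hT a (by simpa using h.symm)
    · convert O.comp_mem _ hG' _ hZ using 1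
      ext i
      by_cases hi : i ∈ G'
      · rw [comp_of_eq_zero (erase_of_mem hi)]
        by_cases hZi : Z i = 0
        · rw [erase_of_mem (show i ∈ {i ∈ G' | Z i = 0} from ⟨hi, hZi⟩), hZi]
        · rw [erase_of_notMem fun h => hZi h.2]
          by_contra hne
          exact hc i hi (SignType.eq_neg_of_ne hZi (hT i) (Ne.symm hne))
      · rw [erase_of_notMem fun h => hi h.1, comp_of_ne_zero, erase_of_notMem hi]
        rw [erase_of_notMem hi]
        exact hT i
    · rw [hi.2]
      exact (hT i).symm

/-- A flag to which `T` is adjacent extends to a maximal flag to which `T` is adjacent. -/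
lemma exists_maximal_adjacent (hO : O.Loopfree) {𝓕 : Set (Set E)} (h𝓕 : IsFlag O.toMatroid 𝓕)
    {T : E → SignType} (hT : T ∈ O.adjacentTopes 𝓕) :
    ∃ 𝓖, 𝓕 ⊆ 𝓖 ∧ Maximal (IsFlag O.toMatroid) 𝓖 ∧ T ∈ O.adjacentTopes 𝓖 := by
  obtain ⟨𝓖, hle, ⟨h𝓖, hT𝓖⟩, hmax⟩ := Finite.exists_le_maximal
    (p := fun 𝓖 => IsFlag O.toMatroid 𝓖 ∧ T ∈ O.adjacentTopes 𝓖) ⟨h𝓕, hT⟩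
  refine ⟨𝓖, hle, ⟨h𝓖, fun 𝓗 h𝓗 hsub H hH => ?_⟩, hT𝓖⟩
  by_contra hHG
  obtain ⟨hflat, h0, h1⟩ := h𝓗.1 H hH
  obtain ⟨G, G', hgap, hGH, hHG'⟩ := exists_isGap h𝓖.2 h0 h1 hHG fun A hA =>
    h𝓗.2.subset_or_subset (hsub hA) hH
  obtain ⟨a, haH, haG⟩ := exists_of_ssubset hGH
  obtain ⟨b, hbG', hbH⟩ := exists_of_ssubset hHG'
  have hT0 := hT.1.ne_zero hO
  -- A covector with zero set `H`, signed to oppose `T` at `b`, meets the hypotheses of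
  -- `exists_wall`. The wall `K` need not be `H`, but it still enlarges the flag.
  obtain ⟨Y, hY, hY0, hYb⟩ : ∃ Y ∈ O.covectors, (∀ i ∈ H, Y i = 0) ∧ Y b = -T b := by
    obtain ⟨Y, hY, hYH⟩ := exists_covector_of_isFlat hflat
    by_cases hYb : Y b = T b
    · exact ⟨-Y, O.neg_mem _ hY, fun i hi => by simp [(hYH i).2 hi], by simp [hYb]⟩
    · exact ⟨Y, hY, fun i hi => (hYH i).2 hi,
        SignType.eq_neg_of_ne (fun h => hbH ((hYH b).1 h)) (hT0 b) hYb⟩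
  obtain ⟨hcG, hcG'⟩ := erase_mem_of_isGap hT𝓖 hgap
  obtain ⟨K, hGK, hKG', hK, -⟩ := exists_wall hT0 hcG hcG' (hGH.trans hHG').subset hY
    (fun i hi => hY0 i (hGH.subset hi)) ⟨a, hHG'.subset haH, haG, hY0 a haH⟩ ⟨b, hbG', hYb⟩
  exact hgap.notMem hGK hKG' (hmax ⟨hgap.insert_isFlag h𝓖 (isFlat_of_erase_mem hT0 hK) hGK hKG',
    mem_adjacentTopes_insert hT𝓖 hK⟩ (subset_insert _ _) (mem_insert _ _))

/-! ### Gaps of corank two -/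

section RankTwo

variable {𝓖 : Set (Set E)} {G G' : Set E}

/-- Two nested distinct flats in the gap would extend `𝓖` by two members, against `hcard`: the
interval from `G` to `G'` has rank at most two. -/
lemma flats_eq_of_subset (hgap : IsGap 𝓖 G G') (h𝓖 : IsFlag O.toMatroid 𝓖)
    (hcard : ∀ 𝓕, IsFlag O.toMatroid 𝓕 → 𝓕.ncard ≤ 𝓖.ncard + 1) {A B : Set E}
    (hA : O.toMatroid.IsFlat A) (hB : O.toMatroid.IsFlat B) (hGA : G ⊂ A) (hBG' : B ⊂ G')
    (hAB : A ⊆ B) : A = B := by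
  by_contra hne
  have hBf := hgap.insert_isFlag h𝓖 hB (hGA.trans_subset hAB) hBG'
  have hAG' := (hAB.trans_ssubset hBG')
  have hAf : IsFlag O.toMatroid (insert A (insert B 𝓖)) :=
    hBf.insert hA (IsGap.ne_empty hGA) (ssubset_univ_iff.1 (hAG'.trans_subset (subset_univ _))) (by
      rintro C (rfl | hC)
      · exact Or.inr hAB
      · exact (hgap.subset_or C hC).imp (fun h => h.trans hGA.subset)
          fun h => hAG'.subset.trans h)
  have := hcard _ hAf
  rw [ncard_insert_of_notMem (fun h => h.elim hne (hgap.notMem hGA hAG')) (toFinite _),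
    ncard_insert_of_notMem (hgap.notMem (hGA.trans_subset hAB) hBG') (toFinite _)] at this
  omega

lemma cl_insert_eq (hgap : IsGap 𝓖 G G') (h𝓖 : IsFlag O.toMatroid 𝓖)
    (hcard : ∀ 𝓕, IsFlag O.toMatroid 𝓕 → 𝓕.ncard ≤ 𝓖.ncard + 1) {P : Set E}
    (hP : O.toMatroid.IsFlat P) (hGP : G ⊂ P) (hPG' : P ⊂ G') {a : E} (haP : a ∈ P)
    (haG : a ∉ G) : O.cl (insert a G) = P := by
  have hsub : insert a G ⊆ O.cl (insert a G) := subset_cl _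
  refine flats_eq_of_subset hgap h𝓖 hcard (isFlat_cl _) hP
    ⟨(subset_insert _ _).trans hsub, fun h => haG (h (hsub (mem_insert _ _)))⟩ hPG' ?_
  rw [← isFlat_iff_cl.1 hP]
  exact cl_mono (insert_subset haP hGP.subset)

/-- The elements `a` and `b` are not parallel over `G`. If `V` were nonzero somewhere on `G'`, its
zero set there would be a flat in the gap containing `a`, hence equal to `P`, which misses `b`. -/
lemma eq_zero_of_rankTwo (hgap : IsGap 𝓖 G G') (h𝓖 : IsFlag O.toMatroid 𝓖)
    (hcard : ∀ 𝓕, IsFlag O.toMatroid 𝓕 → 𝓕.ncard ≤ 𝓖.ncard + 1) {P : Set E}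
    (hP : O.toMatroid.IsFlat P) (hGP : G ⊂ P) (hPG' : P ⊂ G') {V : E → SignType}
    (hV : V ∈ O.covectors) (hVG : ∀ i ∈ G, V i = 0) {a b : E} (haP : a ∈ P) (haG : a ∉ G)
    (hVa : V a = 0) (hbG' : b ∈ G') (hbP : b ∉ P) (hVb : V b = 0) {c : E} (hc : c ∈ G') :
    V c = 0 := by
  by_contra hVc
  have hG' : O.toMatroid.IsFlat G' := by
    rcases hgap.right with h | rfl
    exacts [(h𝓖.1 _ h).1, O.toMatroid.ground_isFlat]
  have hK : O.toMatroid.IsFlat {i ∈ G' | V i = 0} := by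
    refine isFlat_iff_cl.2 (Subset.antisymm (fun e he => ⟨?_, ?_⟩) (subset_cl _))
    · rw [← isFlat_iff_cl.1 hG']
      exact cl_mono (sep_subset _ _) he
    · exact he V hV fun i hi => hi.2
  have h1 := cl_insert_eq hgap h𝓖 hcard hP hGP hPG' haP haG
  have h2 := cl_insert_eq hgap h𝓖 hcard hK
    ⟨fun i hi => ⟨hPG'.subset (hGP.subset hi), hVG i hi⟩,
      fun h => haG (h ⟨hPG'.subset haP, hVa⟩)⟩
    ⟨sep_subset _ _, fun h => hVc (h hc).2⟩ (a := a) ⟨hPG'.subset haP, hVa⟩ haG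
  rw [h1] at h2
  exact hbP (h2 ▸ (⟨hbG', hVb⟩ : b ∈ {i ∈ G' | V i = 0}))

/-- A tope has at most two walls in a gap of corank two. -/
lemma not_three_walls (hgap : IsGap 𝓖 G G') (h𝓖 : IsFlag O.toMatroid 𝓖)
    (hcard : ∀ 𝓕, IsFlag O.toMatroid 𝓕 → 𝓕.ncard ≤ 𝓖.ncard + 1) {T : E → SignType}
    (hT : ∀ i, T i ≠ 0) {P Q R : Set E} (hP : erase T P ∈ O.covectors)
    (hQ : erase T Q ∈ O.covectors) (hR : erase T R ∈ O.covectors)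
    (hGP : G ⊂ P) (hPG' : P ⊂ G') (hGQ : G ⊂ Q) (hQG' : Q ⊂ G') (hGR : G ⊂ R) (hRG' : R ⊂ G')
    (hPQ : P ≠ Q) (hPR : P ≠ R) (hQR : Q ≠ R) : False := by
  have hPf := isFlat_of_erase_mem hT hP
  have hQf := isFlat_of_erase_mem hT hQ
  have hRf := isFlat_of_erase_mem hT hR
  have hdisj : ∀ {A B : Set E}, O.toMatroid.IsFlat A → O.toMatroid.IsFlat B → G ⊂ A → A ⊂ G' →
      G ⊂ B → B ⊂ G' → A ≠ B → ∀ x ∈ A, x ∉ G → x ∉ B := fun hA hB h1 h2 h3 h4 hne x hxA hxG hxB =>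
    hne ((cl_insert_eq hgap h𝓖 hcard hA h1 h2 hxA hxG).symm.trans
      (cl_insert_eq hgap h𝓖 hcard hB h3 h4 hxB hxG))
  obtain ⟨p, hpP, hpG⟩ := exists_of_ssubset hGP
  obtain ⟨q, hqQ, hqG⟩ := exists_of_ssubset hGQ
  obtain ⟨r, hrR, hrG⟩ := exists_of_ssubset hGR
  have hpQ := hdisj hPf hQf hGP hPG' hGQ hQG' hPQ p hpP hpG
  have hpR := hdisj hPf hRf hGP hPG' hGR hRG' hPR p hpP hpG
  have hqP := hdisj hQf hPf hGQ hQG' hGP hPG' hPQ.symm q hqQ hqG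
  have hqR := hdisj hQf hRf hGQ hQG' hGR hRG' hQR q hqQ hqG
  have hrP := hdisj hRf hPf hGR hRG' hGP hPG' hPR.symm r hrR hrG
  have hrQ := hdisj hRf hQf hGR hRG' hGQ hQG' hQR.symm r hrR hrG
  -- Over `G`, the three walls are pairwise disjoint. The covector `W` has signs `-T p`, `T q` and
  -- `0` at `p`, `q` and `r`.
  obtain ⟨W, hW, hWr, hW0, hW1⟩ := exists_elim (j := r) hP (O.neg_mem _ hQ)
    (by rw [Pi.neg_apply, erase_of_notMem hrP, erase_of_notMem hrQ, neg_neg])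
    (by rw [erase_of_notMem hrP]; exact hT r)
  have hWp : W p = -T p := by rw [hW0 p (erase_of_mem hpP), Pi.neg_apply, erase_of_notMem hpQ]
  have hWq : W q = T q := by
    have h := erase_of_notMem (T := T) hqP
    rw [hW1 q (h ▸ hT q), h]
    rw [h, Pi.neg_apply, erase_of_mem hqQ, neg_zero, neg_zero]
    exact hT q
  -- Eliminating `p` between `T \ R` and `W` leaves zeros at `p` and `r` but the sign `T q` at `q`,
  -- which rank two forbids.
  obtain ⟨V, hV, hVp, hV0, hV1⟩ := exists_elim (j := p) hR hW
    (by rw [erase_of_notMem hpR, hWp, neg_neg]) (by rw [erase_of_notMem hpR]; exact hT p)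
  have hVq : V q = T q := by
    have h := erase_of_notMem (T := T) hqR
    rw [hV1 q (h ▸ hT q), h]
    rw [h, hWq]
    exact SignType.ne_neg_self (hT q)
  refine hT q (hVq ▸ eq_zero_of_rankTwo hgap h𝓖 hcard hRf hGR hRG' hV (fun i hi => ?_) hrR hrG ?_
    (hPG'.subset hpP) hpR hVp (hQG'.subset hqQ))
  · rw [hV0 i (erase_of_mem (hGR.subset hi)), hW0 i (erase_of_mem (hGP.subset hi)), Pi.neg_apply,
      erase_of_mem (hGQ.subset hi), neg_zero]
  · rw [hV0 r (erase_of_mem hrR), hWr]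

end RankTwo

/-- A tope is adjacent to an even number of the maximal flags that refine a flag of corank one. -/
lemma even_maximal_adjacent (hO : O.Loopfree) {𝓖 : Set (Set E)} (h𝓖 : IsFlag O.toMatroid 𝓖)
    (hcard : ∀ 𝓕, Maximal (IsFlag O.toMatroid) 𝓕 → 𝓕.ncard = 𝓖.ncard + 1) (T : E → SignType) :
    Even {𝓕 | Maximal (IsFlag O.toMatroid) 𝓕 ∧ 𝓖 ⊆ 𝓕 ∧ T ∈ O.adjacentTopes 𝓕}.ncard := by
  rcases {𝓕 | Maximal (IsFlag O.toMatroid) 𝓕 ∧ 𝓖 ⊆ 𝓕 ∧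
    T ∈ O.adjacentTopes 𝓕}.eq_empty_or_nonempty with he | ⟨𝓕₀, h𝓕₀, hsub₀, hT₀⟩
  · simp [he]
  have hcard' : ∀ 𝓕, IsFlag O.toMatroid 𝓕 → 𝓕.ncard ≤ 𝓖.ncard + 1 := by
    intro 𝓕 h𝓕
    obtain ⟨𝓗, hle, h𝓗⟩ := Finite.exists_le_maximal h𝓕
    exact hcard 𝓗 h𝓗 ▸ ncard_le_ncard hle (toFinite _)
  have hmax : ∀ 𝓕, IsFlag O.toMatroid 𝓕 → 𝓕.ncard = 𝓖.ncard + 1 →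
      Maximal (IsFlag O.toMatroid) 𝓕 := by
    intro 𝓕 h𝓕 hc
    refine ⟨h𝓕, fun 𝓗 h𝓗 hle => ?_⟩
    exact (eq_of_subset_of_ncard_le hle (hc ▸ hcard' 𝓗 h𝓗) (toFinite _)).ge
  have hT0 := hT₀.1.ne_zero hO
  have hT := adjacentTopes_anti hsub₀ hT₀
  have hins : ∀ 𝓕, Maximal (IsFlag O.toMatroid) 𝓕 → 𝓖 ⊆ 𝓕 → ∃ R ∉ 𝓖, insert R 𝓖 = 𝓕 :=
    fun 𝓕 h𝓕 hsub => (exists_eq_insert_iff_ncard (toFinite _)).2 ⟨hsub, (hcard 𝓕 h𝓕).symm⟩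
  obtain ⟨P, hP𝓖, rfl⟩ := hins 𝓕₀ h𝓕₀ hsub₀
  obtain ⟨hPf, hP0, hP1⟩ := h𝓕₀.1.1 P (mem_insert _ _)
  obtain ⟨G, G', hgap, hGP, hPG'⟩ := exists_isGap h𝓖.2 hP0 hP1 hP𝓖 fun A hA =>
    h𝓕₀.1.2.subset_or_subset (mem_insert_of_mem _ hA) (mem_insert _ _)
  obtain ⟨hcG, hcG'⟩ := erase_mem_of_isGap hT hgap
  have hcP := hT₀.2 P (mem_insert _ _)
  obtain ⟨a, haP, haG⟩ := exists_of_ssubset hGP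
  obtain ⟨b, hbG', hbP⟩ := exists_of_ssubset hPG'
  -- The covector `-(T \ P)` vanishes on `P` and opposes `T` off `P`. The resulting wall `Q`
  -- contains only points of opposition outside `G`, so it differs from `P`.
  obtain ⟨Q, hGQ, hQG', hcQ, hQP⟩ := exists_wall hT0 hcG hcG' (hGP.trans hPG').subset
    (O.neg_mem _ hcP) (fun i hi => by rw [Pi.neg_apply, erase_of_mem (hGP.subset hi), neg_zero])
    ⟨a, hPG'.subset haP, haG, by rw [Pi.neg_apply, erase_of_mem haP, neg_zero]⟩
    ⟨b, hbG', by rw [Pi.neg_apply, erase_of_notMem hbP]⟩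
  have hPQ : P ≠ Q := by
    rintro rfl
    have := hQP a haP haG
    rw [Pi.neg_apply, erase_of_mem haP, neg_zero] at this
    exact hT0 a (by simpa using this.symm)
  have hQ𝓖 := hgap.notMem hGQ hQG'
  have heq : {𝓕 | Maximal (IsFlag O.toMatroid) 𝓕 ∧ 𝓖 ⊆ 𝓕 ∧ T ∈ O.adjacentTopes 𝓕} =
      {insert P 𝓖, insert Q 𝓖} := by
    refine Subset.antisymm ?_ ?_
    · rintro 𝓕 ⟨h𝓕, hsub, hT𝓕⟩
      obtain ⟨R, hR𝓖, rfl⟩ := hins 𝓕 h𝓕 hsub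
      by_contra hne
      have hPR : P ≠ R := fun h => hne (h ▸ Or.inl rfl)
      have hQR : Q ≠ R := fun h => hne (h ▸ Or.inr rfl)
      obtain ⟨hRf, hR0, hR1⟩ := h𝓕.1.1 R (mem_insert _ _)
      -- If comparable with `R`, the flat `P` would belong to the maximal flag `insert R 𝓖`.
      -- Incomparability then forces `R` into the same gap as `P`.
      have hP_notMem : ¬ (P ⊆ R ∨ R ⊆ P) := by
        intro hcomp
        refine (mem_of_maximal_isFlag h𝓕 hPf hP0 hP1 ?_).elim hPR hP𝓖
        rintro A (rfl | hA)
        · exact hcomp.symm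
        · exact h𝓕₀.1.2.subset_or_subset (mem_insert_of_mem _ hA) (mem_insert _ _)
      have hGR : G ⊆ R := by
        rcases hgap.left with h | rfl
        · rcases h𝓕.1.2.subset_or_subset (mem_insert_of_mem _ h) (mem_insert R 𝓖) with h | h
          exacts [h, absurd (Or.inr (h.trans hGP.subset)) hP_notMem]
        · exact empty_subset _
      have hRG' : R ⊆ G' := by
        rcases hgap.right with h | rfl
        · rcases h𝓕.1.2.subset_or_subset (mem_insert_of_mem _ h) (mem_insert R 𝓖) with h | h
          exacts [absurd (Or.inl (hPG'.subset.trans h)) hP_notMem, h]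
        · exact subset_univ _
      refine not_three_walls hgap h𝓖 hcard' hT0 hcP hcQ (hT𝓕.2 R (mem_insert _ _)) hGP hPG' hGQ
        hQG' ⟨hGR, fun h => hP_notMem (Or.inr (h.trans hGP.subset))⟩
        ⟨hRG', fun h => hP_notMem (Or.inl (hPG'.subset.trans h))⟩ hPQ hPR hQR
    · rintro 𝓕 (rfl | rfl)
      · exact ⟨h𝓕₀, hsub₀, hT₀⟩
      · refine ⟨hmax _ (hgap.insert_isFlag h𝓖 (isFlat_of_erase_mem hT0 hcQ) hGQ hQG')
          (ncard_insert_of_notMem hQ𝓖 (toFinite _)), subset_insert _ _,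
          mem_adjacentTopes_insert hT hcQ⟩
  rw [heq, ncard_pair]
  · exact even_two
  · intro h
    exact ((h ▸ mem_insert P 𝓖 : P ∈ insert Q 𝓖)).elim hPQ hP𝓖

end Basic

end OrientedMatroid

/-! ### The real phase structure of an oriented matroid -/

namespace OrientedMatroid

open SignVec

variable {E : Type*}

lemma _root_.SignVec.ofZMod_ne_zero (ε : E → ZMod 2) (i : E) : ofZMod ε i ≠ 0 := by
  unfold ofZMod
  split_ifs <;> decide

lemma _root_.SignVec.exists_ofZMod_eq {T : E → SignType} (hT : ∀ i, T i ≠ 0) :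
    ∃ ε, ofZMod ε = T := by
  refine ⟨fun i => if T i = 1 then 0 else 1, funext fun i => ?_⟩
  by_cases h : T i = 1
  · simp [ofZMod, h]
  · simpa [ofZMod, h] using (SignType.eq_neg_of_ne (hT i) one_ne_zero h).symm

lemma _root_.SignVec.sub_eq_sub_iff_ofZMod (ε δ : E → ZMod 2) (i j : E) :
    (ε - δ) i = (ε - δ) j ↔ (ofZMod ε i = ofZMod δ i ↔ ofZMod ε j = ofZMod δ j) := by
  simp only [Pi.sub_apply, ofZMod]
  generalize ε i = a
  generalize ε j = b
  generalize δ i = c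
  generalize δ j = d
  revert a b c d
  decide

variable [Finite E] {O : OrientedMatroid E}

lemma mem_phase {𝓕 : Set (Set E)} (h𝓕 : Maximal (IsFlag O.toMatroid) 𝓕) {σ : facets O.fan}
    (hσ : flagCone 𝓕 = (σ : PointedCone ℝ (E → ℝ))) {ε : E → ZMod 2} :
    ε ∈ O.phase σ ↔ ofZMod ε ∈ O.adjacentTopes 𝓕 := by
  refine ⟨?_, fun h => ⟨𝓕, h𝓕, hσ, h⟩⟩
  rintro ⟨𝓖, h𝓖, hσ', h⟩
  rwa [h𝓕.1.flagCone_injective h𝓖.1 (hσ.trans hσ'.symm)]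

lemma flagCone_mem_facets {𝓕 : Set (Set E)} (h𝓕 : Maximal (IsFlag O.toMatroid) 𝓕) :
    flagCone 𝓕 ∈ facets O.fan := mem_facets_matroidFan.2 ⟨𝓕, h𝓕, rfl⟩

/-- This replaces the union over facets by a condition on `𝓖` alone. A facet containing the cone
comes from a finer flag, and conversely `exists_maximal_adjacent` supplies a facet. -/
lemma mem_phaseAt (hO : O.Loopfree) {𝓖 : Set (Set E)} (h𝓖 : IsFlag O.toMatroid 𝓖)
    {ε : E → ZMod 2} :
    ε ∈ phaseAt O.phase (flagCone 𝓖) ↔ ofZMod ε ∈ O.adjacentTopes 𝓖 := by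
  simp only [phaseAt, mem_iUnion]
  constructor
  · rintro ⟨σ, hle, 𝓕, h𝓕, hσ, hε⟩
    rw [← hσ] at hle
    exact adjacentTopes_anti ((h𝓖.flagCone_le_iff h𝓕.1).1 hle) hε
  · intro h
    obtain ⟨𝓕, hsub, h𝓕, hε⟩ := exists_maximal_adjacent hO h𝓖 h
    exact ⟨⟨_, flagCone_mem_facets h𝓕⟩, flagCone_mono hsub, (mem_phase h𝓕 rfl).2 hε⟩

/-- The difference `ε - ε₀` is constant on an atom exactly when the two sign vectors agree there up
to a global sign. -/
lemma phase_eq_affineSubspace (hO : O.Loopfree) {𝓕 : Set (Set E)}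
    (h𝓕 : Maximal (IsFlag O.toMatroid) 𝓕) {ε₀ : E → ZMod 2}
    (hε₀ : ofZMod ε₀ ∈ O.adjacentTopes 𝓕) {σ : facets O.fan}
    (hσ : flagCone 𝓕 = (σ : PointedCone ℝ (E → ℝ))) :
    (AffineSubspace.mk' ε₀ (constOnAtoms (ZMod 2) 𝓕) : Set (E → ZMod 2)) = O.phase σ := by
  ext ε
  rw [SetLike.mem_coe, AffineSubspace.mem_mk', vsub_eq_sub, mem_phase h𝓕 hσ]
  constructor
  · intro h
    exact mem_adjacentTopes_of_agree hO h𝓕.1.2 hε₀ (ofZMod_ne_zero ε) fun i j hij =>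
      ((sub_eq_sub_iff_ofZMod ε ε₀ i j).1 (h i j hij)).1
  · intro h i j hij
    exact (sub_eq_sub_iff_ofZMod ε ε₀ i j).2 ⟨agree_of_mem_adjacentTopes hO h𝓕 hε₀ h hij,
      agree_of_mem_adjacentTopes hO h𝓕 hε₀ h ((atomSetoid 𝓕).symm hij)⟩

lemma even_ncard_facets (hO : O.Loopfree) {𝓖 : Set (Set E)} (h𝓖 : IsFlag O.toMatroid 𝓖)
    (hcard : ∀ 𝓕, Maximal (IsFlag O.toMatroid) 𝓕 → 𝓕.ncard = 𝓖.ncard + 1) (ε : E → ZMod 2) :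
    Even {σ : facets O.fan | flagCone 𝓖 ≤ (σ : PointedCone ℝ (E → ℝ)) ∧ ε ∈ O.phase σ}.ncard := by
  have h := even_maximal_adjacent hO h𝓖 hcard (ofZMod ε)
  rw [← InjOn.ncard_image (f := flagCone) fun 𝓕 h𝓕 𝓗 h𝓗 heq =>
    h𝓕.1.1.flagCone_injective h𝓗.1.1 heq] at h
  rw [← ncard_image_of_injective _ Subtype.val_injective]
  convert h using 2
  ext σ
  constructor
  · rintro ⟨σ, ⟨hle, 𝓕, h𝓕, hσ, hε⟩, rfl⟩
    rw [← hσ] at hle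
    exact ⟨𝓕, ⟨h𝓕, (h𝓖.flagCone_le_iff h𝓕.1).1 hle, hε⟩, hσ⟩
  · rintro ⟨𝓕, ⟨h𝓕, hsub, hε⟩, rfl⟩
    exact ⟨⟨_, flagCone_mem_facets h𝓕⟩, ⟨flagCone_mono hsub, (mem_phase h𝓕 rfl).2 hε⟩, rfl⟩

/-- `ℰ_𝓜` is a real phase structure on `Σ_M`. -/
theorem exists_isRealPhaseStructure_phase (hO : O.Loopfree) :
    ∃ d, IsRealPhaseStructure O.fan d O.phase := by
  obtain ⟨𝓕₀, -, h𝓕₀⟩ := Finite.exists_le_maximal (p := IsFlag O.toMatroid)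
    (a := ∅) ⟨fun F hF => hF.elim, IsChain.empty⟩
  have hatoms : ∀ 𝓕, Maximal (IsFlag O.toMatroid) 𝓕 →
      Nat.card (Quotient (atomSetoid 𝓕)) = Nat.card (Quotient (atomSetoid 𝓕₀)) :=
    fun 𝓕 h𝓕 => card_atoms_eq hO h𝓕 h𝓕₀
  refine ⟨Nat.card (Quotient (atomSetoid 𝓕₀)), matroidFan_isRationalFan _, ?_, ?_, ?_⟩
  · intro σ hσ
    obtain ⟨𝓕, h𝓕, rfl⟩ := mem_facets_matroidFan.1 hσ
    rw [coneDim_flagCone h𝓕.1.2, hatoms 𝓕 h𝓕]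
  · rintro ⟨σ, hσ⟩
    obtain ⟨𝓕, h𝓕, rfl⟩ := mem_facets_matroidFan.1 hσ
    obtain ⟨T, hT⟩ := adjacentTopes_nonempty hO h𝓕.1
    obtain ⟨ε₀, rfl⟩ := exists_ofZMod_eq (hT.1.ne_zero hO)
    refine ⟨AffineSubspace.mk' ε₀ (constOnAtoms (ZMod 2) 𝓕), ⟨ε₀, AffineSubspace.self_mem_mk' _ _⟩,
      phase_eq_affineSubspace hO h𝓕 hT rfl, ?_, ?_⟩
    · rw [AffineSubspace.direction_mk', finrank_constOnAtoms, hatoms 𝓕 h𝓕]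
    · rw [AffineSubspace.direction_mk', tangentZMod2_flagCone h𝓕.1.2]
  · rintro _ ⟨𝓖, h𝓖, rfl⟩ hdim ε
    rw [coneDim_flagCone h𝓖.2] at hdim
    -- The count of atoms as members plus one fails for empty `E`, but then the dimension is zero
    -- and there is no cone of codimension one.
    have : Nonempty E := by
      have hpos : Nat.card (Quotient (atomSetoid 𝓕₀)) ≠ 0 := by omega
      obtain ⟨q⟩ := (Nat.card_ne_zero.1 hpos).1
      exact ⟨q.out⟩
    refine even_ncard_facets hO h𝓖 (fun 𝓕 h𝓕 => ?_) ε
    have h := hatoms 𝓕 h𝓕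
    rw [← hdim, card_atoms h𝓕.1.2 fun F hF => (h𝓕.1.1 F hF).2,
      card_atoms h𝓖.2 fun F hF => (h𝓖.1 F hF).2] at h
    omega

/-! ### Comparison of two oriented matroids. -/

lemma IsQuotient.isFlag {O₁ O₂ : OrientedMatroid E} (h : IsQuotient O₁ O₂) {𝓕 : Set (Set E)}
    (h𝓕 : IsFlag O₁.toMatroid 𝓕) : IsFlag O₂.toMatroid 𝓕 := by
  refine ⟨fun F hF => ⟨?_, (h𝓕.1 F hF).2⟩, h𝓕.2⟩
  obtain ⟨X, hX, hX0⟩ := (O₁.isFlat_iff F).1 (h𝓕.1 F hF).1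
  exact (O₂.isFlat_iff F).2 ⟨X, h hX, hX0⟩

lemma IsQuotient.adjacentTopes_subset {O₁ O₂ : OrientedMatroid E} (h : IsQuotient O₁ O₂)
    (h₁ : O₁.Loopfree) (𝓕 : Set (Set E)) : O₁.adjacentTopes 𝓕 ⊆ O₂.adjacentTopes 𝓕 :=
  fun _ hT => ⟨isTope_of_ne_zero (h hT.1.1) (hT.1.ne_zero h₁), fun F hF => h (hT.2 F hF)⟩

lemma isQuotient_of_phaseAt_subset {O₁ O₂ : OrientedMatroid E} (h₁ : O₁.Loopfree)
    (h₂ : O₂.Loopfree) (hfan : O₁.fan ⊆ O₂.fan)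
    (hphase : ∀ τ ∈ O₁.fan, phaseAt O₁.phase τ ⊆ phaseAt O₂.phase τ) : IsQuotient O₁ O₂ := by
  have key : ∀ 𝓖, IsFlag O₁.toMatroid 𝓖 → ∀ T ∈ O₁.adjacentTopes 𝓖, T ∈ O₂.adjacentTopes 𝓖 := by
    intro 𝓖 h𝓖 T hT
    obtain ⟨ε, rfl⟩ := exists_ofZMod_eq (hT.1.ne_zero h₁)
    have hmem := hphase _ ⟨𝓖, h𝓖, rfl⟩ ((mem_phaseAt h₁ h𝓖).2 hT)
    obtain ⟨𝓗, h𝓗, heq⟩ := hfan ⟨𝓖, h𝓖, rfl⟩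
    rw [← heq, mem_phaseAt h₂ h𝓗] at hmem
    refine adjacentTopes_anti ?_ hmem
    exact (flagCone_le_iff h𝓗.2 fun F hF => (h𝓖.1 F hF).2).1 heq.ge
  intro X hX
  obtain ⟨T₀, hT₀, hT₀0⟩ := exists_tope h₁
  have hTX : ∀ i, X i ≠ 0 → comp X T₀ i = X i := fun i => comp_of_ne_zero
  have hT0 : ∀ i, comp X T₀ i ≠ 0 := fun i => by
    by_cases hi : X i = 0
    · rw [comp_of_eq_zero hi]
      exact hT₀0 i
    · rwa [hTX i hi]
  have hX' : erase (comp X T₀) {i | X i = 0} = X := by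
    ext i
    by_cases hi : X i = 0
    · rw [erase_of_mem (show i ∈ {i | X i = 0} from hi), hi]
    · rw [erase_of_notMem (show i ∉ {i | X i = 0} from hi), hTX i hi]
  have hT := isTope_of_ne_zero (O₁.comp_mem X hX T₀ hT₀) hT0
  -- Flags contain only proper nonempty flats. A nowhere zero `X` is handled by the empty flag, and
  -- a zero set equal to `univ` means `X = 0`.
  by_cases h0 : {i | X i = 0} = ∅
  · have h := (key ∅ ⟨fun F hF => hF.elim, IsChain.empty⟩ _ ⟨hT, fun F hF => hF.elim⟩).1.1
    rwa [← erase_empty (comp X T₀), ← h0, hX'] at h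
  by_cases h1 : {i | X i = 0} = univ
  · rw [← hX', h1, erase_univ]
    exact O₂.zero_mem
  have h := (key {{i | X i = 0}} ⟨?_, IsChain.singleton⟩ _ ⟨hT, ?_⟩).2 _ rfl
  · rwa [hX'] at h
  · rintro F rfl
    exact ⟨(O₁.isFlat_iff _).2 ⟨X, hX, rfl⟩, h0, h1⟩
  · rintro F rfl
    rwa [hX']

end OrientedMatroid

end

theorem proposition3p8 {E : Type*} [Finite E] (O₁ O₂ : OrientedMatroid E)
    (h₁ : O₁.Loopfree) (h₂ : O₂.Loopfree) :
    OrientedMatroid.IsQuotient O₁ O₂ ↔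
      IsRealSubfan O₁.fan O₁.phase O₂.fan O₂.phase := by
  refine ⟨fun h => ⟨OrientedMatroid.exists_isRealPhaseStructure_phase h₁,
    OrientedMatroid.exists_isRealPhaseStructure_phase h₂, ?_, ?_⟩,
    fun h => OrientedMatroid.isQuotient_of_phaseAt_subset h₁ h₂ h.subset h.phase_subset⟩
  · rintro _ ⟨𝓕, h𝓕, rfl⟩
    exact ⟨𝓕, h.isFlag h𝓕, rfl⟩
  · rintro _ ⟨𝓖, h𝓖, rfl⟩ ε hε
    rw [OrientedMatroid.mem_phaseAt h₁ h𝓖] at hε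
    rw [OrientedMatroid.mem_phaseAt h₂ (h.isFlag h𝓖)]
    exact h.adjacentTopes_subset h₁ 𝓖 hε
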